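/- Let $m\ge 2$ and $n\ge 1$ be integers. For a linear map $A:\mathbb R^m\to\mathbb R^n$ and a bilinear map $B:\mathbb R^m\times\mathbb R^m\to\mathbb R^n$ write $$|||A|||=\sup_{|v|=1}|A(v)|,\qquad |||B|||=\sup_{|v|=1}|B(v,v)|,$$ where $|\cdot|$ is the Euclidean norm. Let $\Omega\subset\mathbb R^m$ be a (nonempty) bounded, convex domain with $C^2$ boundary, let $\phi:\overline\Omega\to\mathbb R^n$ be $C^2$ on $\overline\Omega$, and suppose that for some $\kappa\in(0,1)$ $$\frac{4m\,\operatorname{diam}\Omega}{\kappa}\,\sup_{\Omega}|||D^2\phi|||+2\sup_{\partial\Omega}|||D\phi|||<\sqrt{1-\kappa^{1/m}}.$$ Let $u:\overline\Omega\to\mathbb R^n$ be a smooth solution ($C^\infty$ in $\Omega$ and $C^1$ on $\overline\Omega$) of the maximal graph Dirichlet problem $$\sum_{i,j=1}^m g^{ij}(Du)\,\frac{\partial^2u}{\partial x^i\partial x^j}=0\ \text{ and }\ |||Du|||<1\ \text{ in }\Omega,\qquad u=\phi\ \text{ on }\partial\Omega,$$ where $(g^{ij}(Du))$ is the inverse of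 the matrix $g=I-(Du)^{T}Du$. If $\sup_\Omega|||Du|||^2\le 1-\kappa$, then $$\sup_\Omega|||Du|||^2<1-\kappa .$$ -/

import Mathlib

open Set Metric
open scoped ContDiff

namespace MaximalGraph

/-- `ℝᵏ` with its Euclidean norm. -/
abbrev E (k : ℕ) : Type := EuclideanSpace ℝ (Fin k)

/-- `|||A||| = sup_{|v| = 1} |A v|` for a linear map `A : ℝᵐ → ℝⁿ`. -/
noncomputable def supNorm {m n : ℕ} (A : E m →L[ℝ] E n) : ℝ :=
  sSup ((fun v : E m => ‖A v‖) '' sphere (0 : E m) 1)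

/-- `|||B||| = sup_{|v| = 1} |B(v, v)|` for a bilinear map `B : ℝᵐ × ℝᵐ → ℝⁿ`. -/
noncomputable def supNorm₂ {m n : ℕ}
    (B : ContinuousMultilinearMap ℝ (fun _ : Fin 2 => E m) (E n)) : ℝ :=
  sSup ((fun v : E m => ‖B ![v, v]‖) '' sphere (0 : E m) 1)

/-- The standard basis vectors of `ℝᵐ`. -/
noncomputable def stdVec {m : ℕ} (i : Fin m) : E m := EuclideanSpace.single i (1 : ℝ)

/-- The Jacobian matrix `(∂u^γ / ∂x^i)` of `u : ℝᵐ → ℝⁿ` at `x`. -/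
noncomputable def jacobian {m n : ℕ} (u : E m → E n) (x : E m) : Matrix (Fin n) (Fin m) ℝ :=
  Matrix.of fun γ i => fderiv ℝ u x (stdVec i) γ

open scoped Matrix in
/-- The metric `g = I - Duᵀ Du` that the semi-Euclidean space `ℝᵐ⁺ⁿₙ` induces on the graph
of `u`. -/
noncomputable def inducedMetric {m n : ℕ} (u : E m → E n) (x : E m) :
    Matrix (Fin m) (Fin m) ℝ :=
  1 - (jacobian u x)ᵀ * jacobian u x

/-- The vector `g^{ij}(Du) ∂²u / ∂x^i ∂x^j` at `x`, where `(g^{ij})` is the inverse of `g`. -/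
noncomputable def maximalOperator {m n : ℕ} (u : E m → E n) (x : E m) : E n :=
  ∑ i : Fin m, ∑ j : Fin m,
    ((inducedMetric u x)⁻¹ i j) • iteratedFDeriv ℝ 2 u x ![stdVec i, stdVec j]

/-- `Ω` has `C²` boundary: near each boundary point, `Ω` is the sublevel set `{ρ < 0}` of a `C²`
function `ρ` without critical points. -/
def HasC2Boundary {m : ℕ} (Ω : Set (E m)) : Prop :=
  ∀ p ∈ frontier Ω, ∃ (U : Set (E m)) (ρ : E m → ℝ),
    IsOpen U ∧ p ∈ U ∧ ContDiffOn ℝ 2 ρ U ∧ (∀ x ∈ U, fderiv ℝ ρ x ≠ 0) ∧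
      Ω ∩ U = {x ∈ U | ρ x < 0}

/-- `u` is a smooth solution of the maximal graph Dirichlet problem in `Ω` with boundary values
`φ`: it is smooth in `Ω` and `C¹` up to the boundary, its graph is spacelike with zero mean
curvature, and `u = φ` on `∂Ω`. -/
structure IsSmoothSolution {m n : ℕ} (Ω : Set (E m)) (φ u : E m → E n) : Prop where
  smooth : ContDiffOn ℝ ∞ u Ω
  contDiffOn_closure : ContDiffOn ℝ 1 u (closure Ω)
  maximal : ∀ x ∈ Ω, maximalOperator u x = 0
  spacelike : ∀ x ∈ Ω, supNorm (fderiv ℝ u x) < 1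
  boundary : ∀ x ∈ frontier Ω, u x = φ x

end MaximalGraph

/-!
Along a maximal graph the function `log det g` is superharmonic for the elliptic operator
`∑ gⁱʲ ∂ᵢ∂ⱼ`: completing squares in its second derivatives leaves a sum of squares with a negative
sign. Hence `det g` attains its minimum over `closure Ω` on `frontier Ω`.

The hypothesis `‖Du‖² ≤ 1 - κ` says that the eigenvalues of `g` lie in `[κ, 1]`, so that
`tr g⁻¹ ≤ m / κ` and `g⁻¹ ≥ 1`. Comparing `u - φ` with a concave quadratic function that vanishes on
a supporting hyperplane at `p ∈ frontier Ω` and has slope proportional to `diam Ω` there bounds the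
derivative of `u - φ` at `p` in the directions of the tangent cone of `Ω`; along the boundary of
that cone the derivative vanishes, and so `‖Du(p)‖ ≤ c` with
`c := (m diam Ω / κ) sup |||D²φ||| + sup |||Dφ||| < √(1 - κ^(1/m))`.

Therefore `det g ≥ (1 - c²)ᵐ > κ` on `frontier Ω` and so on all of `Ω`. As the eigenvalues of `g`
are at most `1`, each of them is at least `det g`, which means that `‖Du‖² ≤ 1 - (1 - c²)ᵐ < 1 - κ`.
-/

namespace MaximalGraph

/-- The second derivative `D²f(x)` as a curried bilinear map. -/
noncomputable abbrev hessian {X G : Type*} [NormedAddCommGroup X] [NormedSpace ℝ X]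
    [NormedAddCommGroup G] [NormedSpace ℝ G] (f : X → G) (x : X) : X →L[ℝ] X →L[ℝ] G :=
  fderiv ℝ (fderiv ℝ f) x

section Hessian

open scoped InnerProductSpace Topology

variable {X G H : Type*} [NormedAddCommGroup X] [NormedSpace ℝ X] [NormedAddCommGroup G]
  [NormedSpace ℝ G] [NormedAddCommGroup H] [NormedSpace ℝ H] {f h : X → G} {x : X}

lemma differentiableAt_fderiv (hf : ContDiffAt ℝ 2 f x) : DifferentiableAt ℝ (fderiv ℝ f) x :=
  (hf.fderiv_right (m := 1) (by norm_num)).differentiableAt one_ne_zero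

lemma hessian_apply (hf : ContDiffAt ℝ 2 f x) (v w : X) :
    hessian f x v w = fderiv ℝ (fun y => fderiv ℝ f y w) x v := by
  simp [fderiv_clm_apply (differentiableAt_fderiv hf) (differentiableAt_const w)]

lemma hessian_symm (hf : ContDiffAt ℝ 2 f x) (v w : X) : hessian f x v w = hessian f x w v :=
  (hf.isSymmSndFDerivAt (by simp)).eq v w

lemma eventually_differentiableAt (hf : ContDiffAt ℝ 2 f x) :
    ∀ᶠ y in 𝓝 x, DifferentiableAt ℝ f y :=
  (hf.eventually (by simp)).mono fun _ hy => hy.differentiableAt two_ne_zero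

lemma hessian_add (hf : ContDiffAt ℝ 2 f x) (hh : ContDiffAt ℝ 2 h x) :
    hessian (fun y => f y + h y) x = hessian f x + hessian h x := by
  have hgrad : fderiv ℝ (fun y => f y + h y) =ᶠ[𝓝 x] fun y => fderiv ℝ f y + fderiv ℝ h y := by
    filter_upwards [eventually_differentiableAt hf, eventually_differentiableAt hh] with y hfy hhy
    exact fderiv_fun_add hfy hhy
  rw [hessian, hgrad.fderiv_eq, fderiv_fun_add (differentiableAt_fderiv hf)
    (differentiableAt_fderiv hh)]

lemma hessian_const_sub (c : G) : hessian (fun y => c - f y) x = -hessian f x := by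
  simp only [hessian, funext fun y => fderiv_const_sub (𝕜 := ℝ) (f := f) (x := y) c, fderiv_fun_neg]

lemma hessian_sub (hf : ContDiffAt ℝ 2 f x) (hh : ContDiffAt ℝ 2 h x) :
    hessian (fun y => f y - h y) x = hessian f x - hessian h x := by
  have hneg : hessian (fun y => -h y) x = -hessian h x := by
    simpa only [zero_sub] using hessian_const_sub (f := h) (x := x) 0
  simp only [sub_eq_add_neg, hessian_add hf hh.neg, hneg]

lemma hessian_clm_comp (L : G →L[ℝ] H) (hf : ContDiffAt ℝ 2 f x) (v w : X) :
    hessian (fun y => L (f y)) x v w = L (hessian f x v w) := by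
  have := congrArg (· ![v, w]) (L.iteratedFDeriv_comp_left hf (i := 2) le_rfl)
  simpa [hessian, Function.comp_def, iteratedFDeriv_two_apply] using this

lemma hessian_fderiv_symm (hf : ContDiffAt ℝ 3 f x) (v w z : X) :
    hessian (fderiv ℝ f) x v w z = hessian (fderiv ℝ f) x v z w := by
  have hsymm : (fun y => hessian f y w z) =ᶠ[𝓝 x] fun y => hessian f y z w := by
    filter_upwards [hf.eventually (by simp)] with y hy
    exact hessian_symm (hy.of_le (by norm_num)) w z
  have happly (a b : X) :
      hessian (fderiv ℝ f) x v a b = fderiv ℝ (fun y => hessian f y a b) x v := by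
    have hdiff : DifferentiableAt ℝ (hessian f) x :=
      differentiableAt_fderiv (hf.fderiv_right (m := 2) (by norm_num))
    simp [fderiv_clm_apply, hdiff, hdiff.clm_apply]
  rw [happly, happly, hsymm.fderiv_eq]

section Inner

variable {F : Type*} [NormedAddCommGroup F] [InnerProductSpace ℝ F] {f h : X → F}

lemma hessian_inner_apply_self (hf : ContDiffAt ℝ 2 f x) (hh : ContDiffAt ℝ 2 h x) (v : X) :
    hessian (fun y => ⟪f y, h y⟫_ℝ) x v v = ⟪f x, hessian h x v v⟫_ℝ +
      2 * ⟪fderiv ℝ f x v, fderiv ℝ h x v⟫_ℝ + ⟪hessian f x v v, h x⟫_ℝ := by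
  have hgrad : (fun y => fderiv ℝ (fun z => ⟪f z, h z⟫_ℝ) y v) =ᶠ[𝓝 x]
      fun y => ⟪f y, fderiv ℝ h y v⟫_ℝ + ⟪fderiv ℝ f y v, h y⟫_ℝ := by
    filter_upwards [eventually_differentiableAt hf, eventually_differentiableAt hh] with y hfy hhy
    exact fderiv_inner_apply ℝ hfy hhy v
  have hf1 := hf.differentiableAt two_ne_zero
  have hh1 := hh.differentiableAt two_ne_zero
  have hf2 : DifferentiableAt ℝ (fun y => fderiv ℝ f y v) x :=
    (differentiableAt_fderiv hf).clm_apply (differentiableAt_const v)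
  have hh2 : DifferentiableAt ℝ (fun y => fderiv ℝ h y v) x :=
    (differentiableAt_fderiv hh).clm_apply (differentiableAt_const v)
  rw [hessian_apply (hf.inner ℝ hh), hgrad.fderiv_eq,
    fderiv_fun_add (hf1.inner ℝ hh2) (hf2.inner ℝ hh1), add_apply,
    fderiv_inner_apply ℝ hf1 hh2, fderiv_inner_apply ℝ hf2 hh1, hessian_apply hf, hessian_apply hh]
  ring

end Inner

end Hessian

section Loewner

open scoped MatrixOrder Matrix

variable {ι : Type*} [Fintype ι] [DecidableEq ι] {g : Matrix ι ι ℝ} {c : ℝ}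

lemma isHermitian_algebraMap (c : ℝ) : (algebraMap ℝ (Matrix ι ι ℝ) c).IsHermitian :=
  IsSelfAdjoint.algebraMap _ (IsSelfAdjoint.all c)

lemma isHermitian_of_algebraMap_le (h : algebraMap ℝ _ c ≤ g) : g.IsHermitian := by
  simpa using (Matrix.le_iff.1 h).isHermitian.add (isHermitian_algebraMap c)

lemma le_eigenvalues_of_algebraMap_le (h : algebraMap ℝ _ c ≤ g) (hg : g.IsHermitian) (i : ι) :
    c ≤ hg.eigenvalues i :=
  (algebraMap_le_iff_le_spectrum hg.isSelfAdjoint).1 h _ (hg.eigenvalues_mem_spectrum_real i)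

lemma posDef_of_algebraMap_le (hc : 0 < c) (h : algebraMap ℝ _ c ≤ g) : g.PosDef := by
  have hg := isHermitian_of_algebraMap_le h
  exact hg.posDef_iff_eigenvalues_pos.2 fun i =>
    hc.trans_le (le_eigenvalues_of_algebraMap_le h hg i)

lemma pow_card_le_det (hc : 0 ≤ c) (h : algebraMap ℝ _ c ≤ g) : c ^ Fintype.card ι ≤ g.det := by
  have hg := isHermitian_of_algebraMap_le h
  rw [hg.det_eq_prod_eigenvalues, ← Finset.card_univ, ← Finset.prod_const]
  exact Finset.prod_le_prod (fun _ _ => hc) fun i _ => le_eigenvalues_of_algebraMap_le h hg i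

lemma algebraMap_det_le (h0 : 0 ≤ g) (h1 : g ≤ 1) : algebraMap ℝ _ g.det ≤ g := by
  have hg := (Matrix.nonneg_iff_posSemidef.1 h0).isHermitian
  rw [algebraMap_le_iff_le_spectrum hg.isSelfAdjoint, hg.spectrum_real_eq_range_eigenvalues,
    Set.forall_mem_range]
  intro i
  rw [hg.det_eq_prod_eigenvalues, ← Finset.mul_prod_erase _ _ (Finset.mem_univ i)]
  have hle : ∀ j, hg.eigenvalues j ≤ 1 := fun j =>
    (CFC.le_one_iff g hg.isSelfAdjoint).1 h1 _ (hg.eigenvalues_mem_spectrum_real j)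
  have hge := (Matrix.nonneg_iff_posSemidef.1 h0).eigenvalues_nonneg
  exact mul_le_of_le_one_right (hge i)
    (Finset.prod_le_one (fun j _ => hge j) fun j _ => hle j)

lemma inv_mem_spectrum_of_mem_spectrum_inv (hg : IsUnit g) {r : ℝ} (hr : r ∈ spectrum ℝ g⁻¹) :
    r⁻¹ ∈ spectrum ℝ g := by
  lift g to (Matrix ι ι ℝ)ˣ using hg
  rw [← Matrix.coe_units_inv, ← spectrum.map_inv] at hr
  exact hr

lemma one_le_inv_of_le_one (hg : g.PosDef) (h : g ≤ 1) : 1 ≤ g⁻¹ := by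
  refine (CFC.one_le_iff (R := ℝ) _ hg.isHermitian.inv.isSelfAdjoint).2 fun r hr => ?_
  have hr' := inv_mem_spectrum_of_mem_spectrum_inv hg.isUnit hr
  have hr0 : 0 < r := inv_pos.1 (hg.isStrictlyPositive.spectrum_pos (𝕜 := ℝ) hr')
  exact (inv_le_one₀ hr0).1 ((CFC.le_one_iff g hg.isHermitian.isSelfAdjoint).1 h _ hr')

lemma inv_le_algebraMap_inv (hc : 0 < c) (h : algebraMap ℝ _ c ≤ g) :
    g⁻¹ ≤ algebraMap ℝ _ c⁻¹ := by
  have hg := posDef_of_algebraMap_le hc h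
  refine (le_algebraMap_iff_spectrum_le hg.isHermitian.inv.isSelfAdjoint).2 fun r hr => ?_
  have hr' := (algebraMap_le_iff_le_spectrum hg.isHermitian.isSelfAdjoint).1 h _
    (inv_mem_spectrum_of_mem_spectrum_inv hg.isUnit hr)
  simpa using inv_anti₀ hc hr'

lemma trace_inv_le (hc : 0 < c) (h : algebraMap ℝ _ c ≤ g) :
    g⁻¹.trace ≤ Fintype.card ι / c := by
  have := (Matrix.tracePositiveLinearMap ι ℝ ℝ).monotone' (inv_le_algebraMap_inv hc h)
  simpa [Algebra.algebraMap_eq_smul_one, div_eq_inv_mul] using this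

end Loewner

section MatrixCalculus

open scoped Matrix Matrix.Norms.L2Operator Topology

variable {ι : Type*} [Fintype ι] [DecidableEq ι]

lemma contDiff_det {k : WithTop ℕ∞} : ContDiff ℝ k (Matrix.det : Matrix ι ι ℝ → ℝ) := by
  have hentry (i j : ι) : ContDiff ℝ k fun M : Matrix ι ι ℝ => M i j :=
    (Matrix.entryLinearMap ℝ ℝ i j).toContinuousLinearMap.contDiff
  rw [show (Matrix.det : Matrix ι ι ℝ → ℝ) = _ from funext Matrix.det_apply]
  exact ContDiff.sum fun σ _ => (contDiff_prod fun i _ => hentry _ _).const_smul _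

lemma differentiable_det : Differentiable ℝ (Matrix.det : Matrix ι ι ℝ → ℝ) :=
  contDiff_det.differentiable one_ne_zero

lemma fderiv_det_apply {M : Matrix ι ι ℝ} (hM : IsUnit M) (N : Matrix ι ι ℝ) :
    fderiv ℝ Matrix.det M N = M.det * (M⁻¹ * N).trace := by
  have hline (t : ℝ) : (M + t • N).det = M.det * (1 + t • (M⁻¹ * N)).det := by
    rw [← Matrix.det_mul, mul_add, mul_one, mul_smul_comm, Matrix.mul_nonsing_inv_cancel_left _ _
      (M.isUnit_iff_isUnit_det.1 hM)]
  have hquad (p : Polynomial ℝ) (a : ℝ) :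
      HasDerivAt (fun t => 1 + a * t + p.eval t * t ^ 2) a 0 := by
    simpa using (((hasDerivAt_id (0 : ℝ)).const_mul a).const_add 1).fun_add
      ((p.hasDerivAt 0).fun_mul (hasDerivAt_pow 2 (0 : ℝ)))
  rw [← (differentiable_det M).lineDeriv_eq_fderiv, lineDeriv]
  simp_rw [hline, Matrix.det_one_add_smul _ (M⁻¹ * N)]
  exact ((hquad _ _).const_mul _).deriv

variable {X : Type*} [NormedAddCommGroup X] [NormedSpace ℝ X] {M : X → Matrix ι ι ℝ} {x : X}

lemma fderiv_log_det_apply (hM : DifferentiableAt ℝ M x) (hx : IsUnit (M x)) (v : X) :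
    fderiv ℝ (fun y => Real.log (M y).det) x v = ((M x)⁻¹ * fderiv ℝ M x v).trace := by
  have hdet0 : (M x).det ≠ 0 := ((M x).isUnit_iff_isUnit_det.1 hx).ne_zero
  have hdet : HasFDerivAt (fun y => (M y).det) _ x :=
    (differentiable_det _).hasFDerivAt.comp x hM.hasFDerivAt
  rw [(hdet.log hdet0).fderiv]
  simp [fderiv_det_apply hx, hdet0]

lemma hasFDerivAt_matrix_inv {M' : X →L[ℝ] Matrix ι ι ℝ} (hM : HasFDerivAt M M' x)
    (hx : IsUnit (M x)) : HasFDerivAt (fun y => (M y)⁻¹)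
      (-(ContinuousLinearMap.mulLeftRight ℝ _ (M x)⁻¹ (M x)⁻¹) ∘L M') x := by
  obtain ⟨U, hU⟩ := hx
  simp only [Matrix.nonsing_inv_eq_ringInverse, ← hU, Ring.inverse_unit]
  have := hasFDerivAt_ringInverse (𝕜 := ℝ) U
  rw [hU] at this
  exact this.comp x hM

lemma contDiffAt_log_det {k : WithTop ℕ∞} (hM : ContDiffAt ℝ k M x) (hx : IsUnit (M x)) :
    ContDiffAt ℝ k (fun y => Real.log (M y).det) x :=
  (contDiff_det.contDiffAt.comp x hM).log ((M x).isUnit_iff_isUnit_det.1 hx).ne_zero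

lemma hessian_log_det_apply (hM : ContDiffAt ℝ 2 M x) (hx : IsUnit (M x)) (v w : X) :
    hessian (fun y => Real.log (M y).det) x v w = ((M x)⁻¹ * hessian M x v w).trace
      - ((M x)⁻¹ * fderiv ℝ M x v * ((M x)⁻¹ * fderiv ℝ M x w)).trace := by
  have hunit : ∀ᶠ y in 𝓝 x, IsUnit (M y) :=
    hM.continuousAt.eventually (Units.isOpen.mem_nhds hx)
  have hgrad : (fun y => fderiv ℝ (fun z => Real.log (M z).det) y w) =ᶠ[𝓝 x]
      fun y => ((M y)⁻¹ * fderiv ℝ M y w).trace := by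
    filter_upwards [hunit, hM.eventually (by simp)] with y hy hMy
    exact fderiv_log_det_apply (hMy.differentiableAt two_ne_zero) hy w
  have hinv := hasFDerivAt_matrix_inv (hM.differentiableAt two_ne_zero).hasFDerivAt hx
  have hderiv : HasFDerivAt (fun y => fderiv ℝ M y w) _ x :=
    (differentiableAt_fderiv hM).hasFDerivAt.clm_apply (hasFDerivAt_const w x)
  have htrace : HasFDerivAt (fun y => ((M y)⁻¹ * fderiv ℝ M y w).trace) _ x :=
    (Matrix.traceLinearMap ι ℝ ℝ).toContinuousLinearMap.hasFDerivAt.comp x (hinv.mul' hderiv)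
  rw [hessian_apply (contDiffAt_log_det hM hx), hgrad.fderiv_eq, htrace.fderiv]
  simp [mul_assoc, sub_eq_add_neg]

end MatrixCalculus

section Contraction

open scoped Matrix

variable {m : ℕ} {G : Type*} [NormedAddCommGroup G] [NormedSpace ℝ G]
  {σ : Type*} [Fintype σ]

/-- The trace `∑ Pⁱʲ β(eᵢ, eⱼ)` of a bilinear map `β` against the matrix `P`, linear in `P`. -/
noncomputable def contraction (β : E m →L[ℝ] E m →L[ℝ] G) : Matrix (Fin m) (Fin m) ℝ →ₗ[ℝ] G :=
  ∑ i, ∑ j, (Matrix.entryLinearMap ℝ ℝ i j).smulRight (β (stdVec i) (stdVec j))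

lemma contraction_apply (β : E m →L[ℝ] E m →L[ℝ] G) (P : Matrix (Fin m) (Fin m) ℝ) :
    contraction β P = ∑ i, ∑ j, P i j • β (stdVec i) (stdVec j) := by
  simp [contraction, LinearMap.sum_apply]

lemma maximalOperator_eq_contraction {n : ℕ} (u : E m → E n) (x : E m) :
    maximalOperator u x = contraction (hessian u x) (inducedMetric u x)⁻¹ := by
  simp [maximalOperator, contraction_apply, iteratedFDeriv_two_apply]

lemma sum_smul_stdVec (v : E m) : ∑ i, v i • stdVec i = v := by
  simpa [stdVec] using (EuclideanSpace.basisFun (Fin m) ℝ).sum_repr v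

lemma contraction_vecMulVec (β : E m →L[ℝ] E m →L[ℝ] G) (v w : E m) :
    contraction β (Matrix.vecMulVec v w) = β v w := by
  conv_rhs => rw [← sum_smul_stdVec v, ← sum_smul_stdVec w]
  rw [contraction_apply, Finset.sum_comm]
  simp only [Matrix.vecMulVec_apply, map_sum, map_smul, FunLike.coe_sum, FunLike.coe_smul,
    Finset.sum_apply, Pi.smul_apply, Finset.smul_sum, smul_smul, mul_comm]

/-- The vectors `b` form a frame of the symmetric matrix `P`: `P = ∑ bₛ bₛᵀ`. -/
def IsFrame (P : Matrix (Fin m) (Fin m) ℝ) (b : σ → E m) : Prop :=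
  P = ∑ s, Matrix.vecMulVec (b s) (b s)

variable {P : Matrix (Fin m) (Fin m) ℝ} {b : σ → E m}

lemma exists_isFrame (hP : P.PosSemidef) : ∃ (k : ℕ) (b : Fin k → E m), IsFrame P b := by
  obtain ⟨k, v, hv⟩ := Matrix.posSemidef_iff_eq_sum_vecMulVec.1 hP
  exact ⟨k, fun s => WithLp.toLp 2 (v s), by simpa [IsFrame] using hv⟩

lemma IsFrame.ne_zero (hb : IsFrame P b) (hP : P ≠ 0) : b ≠ 0 := by
  rintro rfl
  exact hP (by simpa [IsFrame] using hb)

lemma IsFrame.contraction_eq (hb : IsFrame P b) (β : E m →L[ℝ] E m →L[ℝ] G) :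
    contraction β P = ∑ s, β (b s) (b s) := by
  simp [hb.symm ▸ map_sum (contraction β) _ _, contraction_vecMulVec]

lemma IsFrame.mul_mul_eq (hb : IsFrame P b) (M : Matrix (Fin m) (Fin m) ℝ) :
    P * M * P = ∑ s, ∑ t, (b s ⬝ᵥ M *ᵥ b t) • Matrix.vecMulVec (b s) (b t) := by
  rw [hb, Finset.sum_mul, Finset.sum_mul_sum]
  simp only [Matrix.vecMulVec_mul, Matrix.vecMul_vecMulVec, Matrix.dotProduct_mulVec,
    Matrix.vecMulVec_smul]

lemma IsFrame.contraction_mul_mul (hb : IsFrame P b) (β : E m →L[ℝ] E m →L[ℝ] G)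
    (M : Matrix (Fin m) (Fin m) ℝ) :
    contraction β (P * M * P) = ∑ s, ∑ t, (b s ⬝ᵥ M *ᵥ b t) • β (b s) (b t) := by
  simp [hb.mul_mul_eq, contraction_vecMulVec]

lemma IsFrame.trace_mul (hb : IsFrame P b) (M : Matrix (Fin m) (Fin m) ℝ) :
    (P * M).trace = ∑ s, b s ⬝ᵥ M *ᵥ b s := by
  rw [hb, Finset.sum_mul, Matrix.trace_sum]
  simp only [Matrix.vecMulVec_mul, Matrix.trace_vecMulVec, Matrix.dotProduct_mulVec,
    dotProduct_comm]

lemma IsFrame.trace_mul_mul_mul (hb : IsFrame P b) (M N : Matrix (Fin m) (Fin m) ℝ) :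
    (P * M * (P * N)).trace = ∑ s, ∑ t, (b s ⬝ᵥ M *ᵥ b t) * (b t ⬝ᵥ N *ᵥ b s) := by
  rw [← mul_assoc, hb.mul_mul_eq]
  simp only [Finset.sum_mul, Matrix.trace_sum, Matrix.smul_mul, Matrix.trace_smul, smul_eq_mul,
    Matrix.vecMulVec_mul, Matrix.trace_vecMulVec, Matrix.dotProduct_mulVec, dotProduct_comm]

lemma IsFrame.trace_eq (hb : IsFrame P b) : P.trace = ∑ s, ‖b s‖ ^ 2 := by
  simpa [EuclideanSpace.real_norm_sq_eq, dotProduct, ← sq] using hb.trace_mul 1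

open scoped InnerProductSpace in
lemma IsFrame.sum_sq_inner (hb : IsFrame P b) (v : E m) :
    ∑ s, ⟪v, b s⟫_ℝ ^ 2 = v ⬝ᵥ P *ᵥ v := by
  rw [hb, Matrix.sum_mulVec, dotProduct_sum]
  refine Finset.sum_congr rfl fun s _ => ?_
  simp [Matrix.vecMulVec_mulVec, sq, EuclideanSpace.inner_eq_star_dotProduct, dotProduct_comm]

end Contraction

section GraphMetric

open scoped Matrix InnerProductSpace MatrixOrder

variable {m : ℕ} {F : Type*} [NormedAddCommGroup F] [InnerProductSpace ℝ F]

/-- The Gram matrix `⟪eᵢ, eⱼ⟫ - ⟪A eᵢ, A eⱼ⟫` of the metric which the semi-Euclidean product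
`ℝᵐ × F`, with `F` negative definite, induces on the graph of the linear map `A`. -/
noncomputable def graphMetric (A : E m →L[ℝ] F) : Matrix (Fin m) (Fin m) ℝ :=
  Matrix.of fun i j => ⟪stdVec i, stdVec j⟫_ℝ - ⟪A (stdVec i), A (stdVec j)⟫_ℝ

lemma inducedMetric_eq_graphMetric {n : ℕ} (u : E m → E n) (x : E m) :
    inducedMetric u x = graphMetric (fderiv ℝ u x) := by
  ext i j
  simp [inducedMetric, graphMetric, jacobian, Matrix.mul_apply, PiLp.inner_apply, stdVec,
    Matrix.one_apply, mul_comm, eq_comm]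

lemma dotProduct_graphMetric_mulVec (A : E m →L[ℝ] F) (v w : E m) :
    v ⬝ᵥ graphMetric A *ᵥ w = ⟪v, w⟫_ℝ - ⟪A v, A w⟫_ℝ := by
  conv_rhs => rw [← sum_smul_stdVec v, ← sum_smul_stdVec w]
  simp only [dotProduct, Matrix.mulVec, graphMetric, Matrix.of_apply, map_sum, map_smul,
    sum_inner, inner_sum, inner_smul_left, inner_smul_right, Finset.mul_sum,
    ← Finset.sum_sub_distrib, RCLike.conj_to_real]
  rw [Finset.sum_comm]
  exact Finset.sum_congr rfl fun i _ => Finset.sum_congr rfl fun j _ => by ring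

lemma graphMetric_isHermitian (A : E m →L[ℝ] F) : (graphMetric A).IsHermitian := by
  ext i j
  simp [graphMetric, real_inner_comm]

lemma le_iff_dotProduct_mulVec_le {M N : Matrix (Fin m) (Fin m) ℝ} (hM : M.IsHermitian)
    (hN : N.IsHermitian) : M ≤ N ↔ ∀ v : E m, v ⬝ᵥ M *ᵥ v ≤ v ⬝ᵥ N *ᵥ v := by
  rw [Matrix.le_iff, Matrix.posSemidef_iff_dotProduct_mulVec, and_iff_right (hN.sub hM),
    (WithLp.equiv 2 (Fin m → ℝ)).symm.surjective.forall]
  simp [Matrix.sub_mulVec, dotProduct_sub]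

lemma dotProduct_algebraMap_mulVec (d : ℝ) (v : E m) :
    v ⬝ᵥ (algebraMap ℝ (Matrix (Fin m) (Fin m) ℝ) d) *ᵥ v = d * ‖v‖ ^ 2 := by
  simp only [Algebra.algebraMap_eq_smul_one, Matrix.smul_mulVec, Matrix.one_mulVec,
    EuclideanSpace.real_norm_sq_eq, dotProduct, Pi.smul_apply, smul_eq_mul, Finset.mul_sum]
  exact Finset.sum_congr rfl fun i _ => by ring

lemma graphMetric_le_one (A : E m →L[ℝ] F) : graphMetric A ≤ 1 := by
  rw [← map_one (algebraMap ℝ _),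
    le_iff_dotProduct_mulVec_le (graphMetric_isHermitian A) (isHermitian_algebraMap 1)]
  intro v
  simp only [dotProduct_graphMetric_mulVec, dotProduct_algebraMap_mulVec,
    real_inner_self_eq_norm_sq]
  linarith [sq_nonneg ‖A v‖]

lemma algebraMap_le_graphMetric_iff {A : E m →L[ℝ] F} {d : ℝ} (hd : d ≤ 1) :
    algebraMap ℝ _ d ≤ graphMetric A ↔ ‖A‖ ^ 2 ≤ 1 - d := by
  have hsq : algebraMap ℝ _ d ≤ graphMetric A ↔ ∀ v, ‖A v‖ ^ 2 ≤ (1 - d) * ‖v‖ ^ 2 := by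
    rw [le_iff_dotProduct_mulVec_le (isHermitian_algebraMap d) (graphMetric_isHermitian A)]
    refine forall_congr' fun v => ?_
    rw [dotProduct_graphMetric_mulVec, dotProduct_algebraMap_mulVec, real_inner_self_eq_norm_sq,
      real_inner_self_eq_norm_sq, sub_mul, one_mul, le_sub_comm]
  rw [hsq, ← Real.le_sqrt (norm_nonneg _) (by linarith), A.opNorm_le_iff (Real.sqrt_nonneg _)]
  refine forall_congr' fun v => ?_
  rw [← sq_le_sq₀ (norm_nonneg _) (by positivity), mul_pow, Real.sq_sqrt (by linarith)]

end GraphMetric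

section GraphMetricCalculus

open scoped Matrix Matrix.Norms.L2Operator InnerProductSpace

variable {m : ℕ} {F : Type*} [NormedAddCommGroup F] [InnerProductSpace ℝ F]
  {X : Type*} [NormedAddCommGroup X] [NormedSpace ℝ X] {A : X → E m →L[ℝ] F} {x : X}

lemma contDiff_graphMetric {k : WithTop ℕ∞} :
    ContDiff ℝ k (graphMetric : (E m →L[ℝ] F) → Matrix (Fin m) (Fin m) ℝ) := by
  have hentries : ContDiff ℝ k fun (A : E m →L[ℝ] F) (i j : Fin m) => graphMetric A i j := by
    refine contDiff_pi.2 fun i => contDiff_pi.2 fun j => contDiff_const.sub ?_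
    exact (contDiff_id.clm_apply contDiff_const).inner ℝ (contDiff_id.clm_apply contDiff_const)
  exact (Matrix.ofLinearEquiv ℝ).toLinearMap.toContinuousLinearMap.contDiff.comp hentries

/-- The evaluation `M ↦ vᵀ M w`, through which derivatives of matrix-valued maps are computed. -/
noncomputable def matrixForm (v w : E m) : Matrix (Fin m) (Fin m) ℝ →L[ℝ] ℝ :=
  LinearMap.toContinuousLinearMap
    { toFun := fun M => v ⬝ᵥ M *ᵥ w
      map_add' := fun M N => by rw [Matrix.add_mulVec, dotProduct_add]
      map_smul' := fun r M => by simp [Matrix.smul_mulVec] }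

lemma matrixForm_apply (v w : E m) (M : Matrix (Fin m) (Fin m) ℝ) :
    matrixForm v w M = v ⬝ᵥ M *ᵥ w := rfl

lemma dotProduct_fderiv_graphMetric_mulVec (hA : DifferentiableAt ℝ A x) (z : X) (v w : E m) :
    v ⬝ᵥ fderiv ℝ (fun y => graphMetric (A y)) x z *ᵥ w =
      -(⟪A x v, fderiv ℝ A x z w⟫_ℝ + ⟪fderiv ℝ A x z v, A x w⟫_ℝ) := by
  have hg : DifferentiableAt ℝ (fun y => graphMetric (A y)) x :=
    (contDiff_graphMetric.differentiable one_ne_zero (A x)).comp x hA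
  have hform : fderiv ℝ (fun y => v ⬝ᵥ graphMetric (A y) *ᵥ w) x z =
      v ⬝ᵥ fderiv ℝ (fun y => graphMetric (A y)) x z *ᵥ w :=
    congrArg (· z) ((matrixForm v w).hasFDerivAt.comp x hg.hasFDerivAt).fderiv
  have hAapply (a : E m) : DifferentiableAt ℝ (fun y => A y a) x :=
    hA.clm_apply (differentiableAt_const a)
  simp [← hform, dotProduct_graphMetric_mulVec, fderiv_const_sub,
    fderiv_inner_apply ℝ (hAapply v) (hAapply w), fderiv_clm_apply hA]

lemma dotProduct_hessian_graphMetric_mulVec (hA : ContDiffAt ℝ 2 A x) (z : X) (v : E m) :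
    v ⬝ᵥ hessian (fun y => graphMetric (A y)) x z z *ᵥ v =
      -2 * (‖fderiv ℝ A x z v‖ ^ 2 + ⟪A x v, hessian A x z z v⟫_ℝ) := by
  have hform := hessian_clm_comp (matrixForm v v) (contDiff_graphMetric.contDiffAt.comp x hA) z z
  have hAv : ContDiffAt ℝ 2 (fun y => A y v) x := hA.clm_apply contDiffAt_const
  have hfderiv : fderiv ℝ (fun y => A y v) x z = fderiv ℝ A x z v := by
    simp [fderiv_clm_apply (hA.differentiableAt two_ne_zero)]
  have hhess : hessian (fun y => A y v) x z z = hessian A x z z v :=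
    hessian_clm_comp (ContinuousLinearMap.apply ℝ F v) hA z z
  rw [← matrixForm_apply, ← Function.comp_def graphMetric A, ← hform]
  simp only [Function.comp_apply, matrixForm_apply, dotProduct_graphMetric_mulVec,
    hessian_const_sub, neg_apply]
  rw [hessian_inner_apply_self hAv hAv, hfderiv, hhess, real_inner_self_eq_norm_sq,
    real_inner_comm (A x v)]
  ring

end GraphMetricCalculus

section SuperharmonicLogDet

open scoped Matrix Matrix.Norms.L2Operator InnerProductSpace Topology

variable {m : ℕ}

lemma fderiv_contraction {X G : Type*} [NormedAddCommGroup X] [NormedSpace ℝ X]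
    [NormedAddCommGroup G] [NormedSpace ℝ G] {β : X → E m →L[ℝ] E m →L[ℝ] G}
    {Q : X → Matrix (Fin m) (Fin m) ℝ} {x : X} (hβ : DifferentiableAt ℝ β x)
    (hQ : DifferentiableAt ℝ Q x) (v : X) :
    fderiv ℝ (fun y => contraction (β y) (Q y)) x v =
      contraction (β x) (fderiv ℝ Q x v) + contraction (fderiv ℝ β x v) (Q x) := by
  have hentry (i j : Fin m) : HasFDerivAt (fun y => Q y i j)
      ((Matrix.entryLinearMap ℝ ℝ i j).toContinuousLinearMap ∘L fderiv ℝ Q x) x :=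
    (Matrix.entryLinearMap ℝ ℝ i j).toContinuousLinearMap.hasFDerivAt.comp x hQ.hasFDerivAt
  have hvalue (i j : Fin m) : DifferentiableAt ℝ (fun y => β y (stdVec i) (stdVec j)) x :=
    (hβ.clm_apply (differentiableAt_const _)).clm_apply (differentiableAt_const _)
  have hterm (i j : Fin m) : fderiv ℝ (fun y => Q y i j • β y (stdVec i) (stdVec j)) x v =
      fderiv ℝ Q x v i j • β x (stdVec i) (stdVec j) +
        Q x i j • fderiv ℝ β x v (stdVec i) (stdVec j) := by
    rw [fderiv_fun_smul (hentry i j).differentiableAt (hvalue i j), (hentry i j).fderiv]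
    simp [fderiv_clm_apply, hβ, hβ.clm_apply, add_comm]
  have hdiff (i j : Fin m) :
      DifferentiableAt ℝ (fun y => Q y i j • β y (stdVec i) (stdVec j)) x :=
    (hentry i j).differentiableAt.fun_smul (hvalue i j)
  simp only [contraction_apply]
  rw [fderiv_fun_sum fun i _ => DifferentiableAt.fun_sum fun j _ => hdiff i j]
  simp only [sum_apply, fderiv_fun_sum fun j _ => hdiff _ j, hterm, Finset.sum_add_distrib]

variable {F : Type*} [NormedAddCommGroup F] [InnerProductSpace ℝ F] {u : E m → F} {x : E m}
  {σ : Type*} [Fintype σ] {b : σ → E m}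

lemma sum_hessian_fderiv_frame (hu : ContDiffAt ℝ 3 u x)
    (hpos : (graphMetric (fderiv ℝ u x)).PosDef)
    (heq : ∀ᶠ y in 𝓝 x, contraction (hessian u y) (graphMetric (fderiv ℝ u y))⁻¹ = 0)
    (hb : IsFrame (graphMetric (fderiv ℝ u x))⁻¹ b) (w : E m) :
    ∑ s, hessian (fderiv ℝ u) x w (b s) (b s) =
      -(2 : ℝ) • ∑ s, ∑ t, ⟪fderiv ℝ u x (b s), hessian u x w (b t)⟫_ℝ •
        hessian u x (b s) (b t) := by
  have hDu : ContDiffAt ℝ 2 (fderiv ℝ u) x := hu.fderiv_right (by norm_num)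
  have hg : DifferentiableAt ℝ (fun y => graphMetric (fderiv ℝ u y)) x :=
    (contDiff_graphMetric.contDiffAt.comp x hDu).differentiableAt two_ne_zero
  have hinv := hasFDerivAt_matrix_inv hg.hasFDerivAt hpos.isUnit
  have hderiv := fderiv_contraction (differentiableAt_fderiv hDu) hinv.differentiableAt w
  have hzero : (fun y => contraction (hessian u y) (graphMetric (fderiv ℝ u y))⁻¹) =ᶠ[𝓝 x]
      fun _ => 0 := heq
  have hswap : ∑ s, ∑ t, ⟪hessian u x w (b s), fderiv ℝ u x (b t)⟫_ℝ •
      hessian u x (b s) (b t) =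
      ∑ s, ∑ t, ⟪fderiv ℝ u x (b s), hessian u x w (b t)⟫_ℝ • hessian u x (b s) (b t) := by
    rw [Finset.sum_comm]
    refine Finset.sum_congr rfl fun t _ => Finset.sum_congr rfl fun s _ => ?_
    rw [real_inner_comm, hessian_symm (hu.of_le (by norm_num)) (b s) (b t)]
  rw [hzero.fderiv_eq, hinv.fderiv, hb.contraction_eq] at hderiv
  simp only [fderiv_fun_const, Pi.zero_apply, zero_apply, neg_apply, map_neg,
    ContinuousLinearMap.comp_apply, ContinuousLinearMap.mulLeftRight_apply,
    hb.contraction_mul_mul,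
    dotProduct_fderiv_graphMetric_mulVec (hDu.differentiableAt two_ne_zero), neg_smul, add_smul,
    Finset.sum_neg_distrib, neg_neg, Finset.sum_add_distrib, hswap] at hderiv
  rw [neg_smul, two_smul, eq_neg_iff_add_eq_zero, add_comm, ← hderiv]

lemma sum_inner_hessian_fderiv_frame (hu : ContDiffAt ℝ 3 u x)
    (hpos : (graphMetric (fderiv ℝ u x)).PosDef)
    (heq : ∀ᶠ y in 𝓝 x, contraction (hessian u y) (graphMetric (fderiv ℝ u y))⁻¹ = 0)
    (hb : IsFrame (graphMetric (fderiv ℝ u x))⁻¹ b) :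
    ∑ s, ∑ t, ⟪fderiv ℝ u x (b t), hessian (fderiv ℝ u) x (b s) (b s) (b t)⟫_ℝ =
      -2 * ∑ s, ∑ t, ∑ r, ⟪fderiv ℝ u x (b t), hessian u x (b s) (b r)⟫_ℝ *
        ⟪fderiv ℝ u x (b r), hessian u x (b s) (b t)⟫_ℝ := by
  have hthird (s t : σ) : hessian (fderiv ℝ u) x (b s) (b s) (b t) =
      hessian (fderiv ℝ u) x (b t) (b s) (b s) := by
    rw [hessian_fderiv_symm hu, hessian_symm (hu.fderiv_right (by norm_num))]
  have hsymm (s t : σ) := hessian_symm (hu.of_le (by norm_num)) (b s) (b t)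
  rw [Finset.sum_comm]
  simp only [hthird, ← inner_sum, sum_hessian_fderiv_frame hu hpos heq hb, inner_smul_right]
  simp only [inner_sum, inner_smul_right, Finset.mul_sum]
  rw [Finset.sum_comm_cycle]
  refine Finset.sum_congr rfl fun s _ => Finset.sum_congr rfl fun t _ =>
    Finset.sum_congr rfl fun r _ => ?_
  rw [hsymm t s, hsymm r s]
  ring

theorem sum_hessian_log_det_graphMetric_nonpos (hu : ContDiffAt ℝ 3 u x)
    (hpos : (graphMetric (fderiv ℝ u x)).PosDef)
    (heq : ∀ᶠ y in 𝓝 x, contraction (hessian u y) (graphMetric (fderiv ℝ u y))⁻¹ = 0)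
    (hb : IsFrame (graphMetric (fderiv ℝ u x))⁻¹ b) :
    ∑ s, hessian (fun y => Real.log (graphMetric (fderiv ℝ u y)).det) x (b s) (b s) ≤ 0 := by
  have hDu : ContDiffAt ℝ 2 (fderiv ℝ u) x := hu.fderiv_right (by norm_num)
  have hg : ContDiffAt ℝ 2 (fun y => graphMetric (fderiv ℝ u y)) x :=
    contDiff_graphMetric.contDiffAt.comp x hDu
  set a : σ → σ → σ → ℝ := fun s t r => ⟪fderiv ℝ u x (b t), hessian u x (b s) (b r)⟫_ℝ
  have hmetric (s t r : σ) :
      b t ⬝ᵥ fderiv ℝ (fun y => graphMetric (fderiv ℝ u y)) x (b s) *ᵥ b r =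
        -(a s t r + a s r t) := by
    rw [dotProduct_fderiv_graphMetric_mulVec (hDu.differentiableAt two_ne_zero),
      real_inner_comm (fderiv ℝ u x (b r))]
  calc ∑ s, hessian (fun y => Real.log (graphMetric (fderiv ℝ u y)).det) x (b s) (b s)
      = -2 * ∑ s, ∑ t, ‖hessian u x (b s) (b t)‖ ^ 2
          - 2 * ∑ s, ∑ t, ⟪fderiv ℝ u x (b t), hessian (fderiv ℝ u) x (b s) (b s) (b t)⟫_ℝ
          - ∑ s, ∑ t, ∑ r, (a s t r + a s r t) ^ 2 := by
        have hmul (s t r : σ) : -(a s t r + a s r t) * -(a s r t + a s t r) =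
            (a s t r + a s r t) ^ 2 := by ring
        simp only [hessian_log_det_apply hg hpos.isUnit, hb.trace_mul, hb.trace_mul_mul_mul,
          dotProduct_hessian_graphMetric_mulVec hDu, hmetric, hmul, Finset.sum_sub_distrib,
          ← Finset.mul_sum, Finset.sum_add_distrib]
        ring
    _ = -2 * ∑ s, ∑ t, ‖hessian u x (b s) (b t)‖ ^ 2
          - ∑ s, ∑ t, ∑ r, (a s t r - a s r t) ^ 2 := by
        -- The differentiated equation turns the third derivatives into the cross terms
        -- `4 * (a s t r * a s r t)`, and these complete the squares.
        rw [sum_inner_hessian_fderiv_frame hu hpos heq hb]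
        have hsq (s t r : σ) :
            (a s t r + a s r t) ^ 2 = (a s t r - a s r t) ^ 2 + 4 * (a s t r * a s r t) := by
          ring
        simp only [hsq, Finset.sum_add_distrib, ← Finset.mul_sum]
        ring
    _ ≤ 0 := by
        have hnorms : 0 ≤ ∑ s, ∑ t, ‖hessian u x (b s) (b t)‖ ^ 2 := by positivity
        have hsquares : 0 ≤ ∑ s, ∑ t, ∑ r, (a s t r - a s r t) ^ 2 := by positivity
        linarith

end SuperharmonicLogDet

section MinimumPrinciple

open Filter Topology
open scoped InnerProductSpace

section SecondDerivativeTest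

variable {X G : Type*} [NormedAddCommGroup X] [NormedSpace ℝ X] [NormedAddCommGroup G]
  [NormedSpace ℝ G]

lemma hasDerivAt_comp_add_smul {f : X → G} {x v : X} {t : ℝ}
    (hf : DifferentiableAt ℝ f (x + t • v)) :
    HasDerivAt (fun s : ℝ => f (x + s • v)) (fderiv ℝ f (x + t • v) v) t := by
  have hline : HasDerivAt (fun s : ℝ => x + s • v) v t := by
    simpa using ((hasDerivAt_id t).smul_const v).const_add x
  exact hf.hasFDerivAt.comp_hasDerivAt t hline

lemma deriv_deriv_comp_add_smul {f : X → G} {x : X} (hf : ContDiffAt ℝ 2 f x) (v : X) :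
    deriv (deriv fun t : ℝ => f (x + t • v)) 0 = hessian f x v v := by
  have hline : Tendsto (fun t : ℝ => x + t • v) (𝓝 0) (𝓝 x) :=
    Continuous.tendsto' (by fun_prop) _ _ (by simp)
  have hderiv : deriv (fun t : ℝ => f (x + t • v)) =ᶠ[𝓝 0]
      fun t => fderiv ℝ f (x + t • v) v := by
    filter_upwards [hline.eventually (eventually_differentiableAt hf)] with t ht
    exact (hasDerivAt_comp_add_smul ht).deriv
  have hgrad : DifferentiableAt ℝ (fderiv ℝ f) (x + (0 : ℝ) • v) := by
    simpa using differentiableAt_fderiv hf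
  rw [hderiv.deriv_eq]
  simpa using ((hasDerivAt_comp_add_smul hgrad).clm_apply (hasDerivAt_const (0 : ℝ) v)).deriv

lemma hessian_nonneg_of_isLocalMin {f : X → ℝ} {x : X} (hf : ContDiffAt ℝ 2 f x)
    (hmin : IsLocalMin f x) (v : X) : 0 ≤ hessian f x v v := by
  set ℓ : ℝ → ℝ := fun t => f (x + t • v)
  have hline : Tendsto (fun t : ℝ => x + t • v) (𝓝 0) (𝓝 x) :=
    Continuous.tendsto' (by fun_prop) _ _ (by simp)
  have hcont : ContinuousAt ℓ 0 :=
    ContinuousAt.comp (g := f) (by simpa using hf.continuousAt) (by fun_prop)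
  have hℓmin : IsLocalMin ℓ 0 := by simpa [IsLocalMin, IsMinFilter, ℓ] using hline.eventually hmin
  by_contra! hneg
  rw [← deriv_deriv_comp_add_smul hf] at hneg
  have hℓmax : IsLocalMax ℓ 0 := isLocalMax_of_deriv_deriv_neg hneg hℓmin.deriv_eq_zero hcont
  have hconst : ℓ =ᶠ[𝓝 0] fun _ => ℓ 0 := by
    filter_upwards [hℓmax, hℓmin] with t hle hge using le_antisymm hle hge
  exact hneg.ne (by simpa using hconst.deriv.deriv_eq)

lemma hessian_clm (L : X →L[ℝ] G) (x : X) : hessian (fun y => L y) x = 0 := by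
  have hgrad : fderiv ℝ (fun y => L y) = fun _ => L := funext fun _ => L.fderiv
  simp [hessian, hgrad]

end SecondDerivativeTest

variable {X : Type*} [NormedAddCommGroup X] [InnerProductSpace ℝ X]

lemma hessian_inner_smul_self (c : ℝ) (x v : X) :
    hessian (fun y => ⟪c • y, y⟫_ℝ) x v v = 2 * c * ‖v‖ ^ 2 := by
  have hsmul := hessian_clm (c • ContinuousLinearMap.id ℝ X) x
  have hid := hessian_clm (ContinuousLinearMap.id ℝ X) x
  simp only [smul_apply, ContinuousLinearMap.id_apply] at hsmul hid
  rw [hessian_inner_apply_self (by fun_prop) (by fun_prop), hsmul, hid,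
    fderiv_fun_const_smul differentiableAt_fun_id]
  simp [inner_smul_left, mul_assoc]

variable [ProperSpace X] {Ω : Set X} {f : X → ℝ} {c : ℝ}

lemma le_of_sum_hessian_neg (hΩ : IsOpen Ω) (hbdd : Bornology.IsBounded Ω)
    (hf : ContinuousOn f (closure Ω)) (hf2 : ∀ x ∈ Ω, ContDiffAt ℝ 2 f x)
    (hneg : ∀ x ∈ Ω, ∃ (k : ℕ) (b : Fin k → X), ∑ s, hessian f x (b s) (b s) < 0)
    (hc : ∀ x ∈ frontier Ω, c ≤ f x) : ∀ x ∈ closure Ω, c ≤ f x := by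
  intro x hx
  obtain ⟨z, hz, hmin⟩ := hbdd.isCompact_closure.exists_isMinOn ⟨x, hx⟩ hf
  have hzΩ : z ∉ Ω := fun hzΩ => by
    obtain ⟨k, b, hb⟩ := hneg z hzΩ
    have hloc : IsLocalMin f z :=
      hmin.isLocalMin (mem_of_superset (hΩ.mem_nhds hzΩ) subset_closure)
    exact hb.not_ge (Finset.sum_nonneg fun s _ =>
      hessian_nonneg_of_isLocalMin (hf2 z hzΩ) hloc (b s))
  exact (hc z ⟨hz, by rwa [hΩ.interior_eq]⟩).trans (hmin hx)

theorem le_of_sum_hessian_nonpos (hΩ : IsOpen Ω) (hbdd : Bornology.IsBounded Ω)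
    (hf : ContinuousOn f (closure Ω)) (hf2 : ∀ x ∈ Ω, ContDiffAt ℝ 2 f x)
    (hnonpos : ∀ x ∈ Ω, ∃ (k : ℕ) (b : Fin k → X), b ≠ 0 ∧ ∑ s, hessian f x (b s) (b s) ≤ 0)
    (hc : ∀ x ∈ frontier Ω, c ≤ f x) : ∀ x ∈ closure Ω, c ≤ f x := by
  intro x hx
  obtain ⟨R, hR⟩ := hbdd.closure.exists_norm_le
  have hperturbed (ε : ℝ) (hε : 0 < ε) : c - ε * R ^ 2 ≤ f x + ⟪-ε • x, x⟫_ℝ := by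
    have hquad : ContDiff ℝ 2 fun y : X => ⟪-ε • y, y⟫_ℝ :=
      (contDiff_id.const_smul (-ε)).inner ℝ contDiff_id
    refine le_of_sum_hessian_neg hΩ hbdd (f := fun y => f y + ⟪-ε • y, y⟫_ℝ)
      (hf.add hquad.continuous.continuousOn) (fun y hy => (hf2 y hy).add hquad.contDiffAt)
      (fun y hy => ?_) (fun y hy => ?_) x hx
    · obtain ⟨k, b, hb, hsum⟩ := hnonpos y hy
      have hpos : 0 < ∑ s, ‖b s‖ ^ 2 := by
        obtain ⟨s, hs⟩ := Function.ne_iff.1 hb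
        exact Finset.sum_pos' (fun _ _ => by positivity)
          ⟨s, Finset.mem_univ s, by have := norm_pos_iff.2 hs; positivity⟩
      refine ⟨k, b, ?_⟩
      simp only [hessian_add (hf2 y hy) hquad.contDiffAt, add_apply, Finset.sum_add_distrib,
        hessian_inner_smul_self, ← Finset.mul_sum]
      nlinarith
    · have hyR : ‖y‖ ^ 2 ≤ R ^ 2 := by
        have := hR y (frontier_subset_closure hy)
        gcongr
      have := hc y hy
      rw [inner_smul_left, real_inner_self_eq_norm_sq]
      simp only [conj_trivial]
      nlinarith
  have hlimit : Tendsto (fun ε : ℝ => c - ε * R ^ 2) (𝓝[>] 0) (𝓝 c) :=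
    (Continuous.tendsto' (by fun_prop) 0 c (by simp)).mono_left nhdsWithin_le_nhds
  refine le_of_tendsto hlimit (eventually_mem_nhdsWithin.mono fun ε (hε : 0 < ε) => ?_)
  have hle : ⟪-ε • x, x⟫_ℝ ≤ 0 := by
    rw [inner_smul_left, real_inner_self_eq_norm_sq]
    simpa using by positivity
  linarith [hperturbed ε hε]

end MinimumPrinciple

section Barrier

open scoped InnerProductSpace

variable {X : Type*} [NormedAddCommGroup X] [InnerProductSpace ℝ X] {Ω : Set X} {p ν : X}

lemma exists_unit_inner_sub_nonneg [CompleteSpace X] (hΩ : IsOpen Ω) (hne : Ω.Nonempty)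
    (hconv : Convex ℝ Ω) (hp : p ∈ frontier Ω) :
    ∃ ν : X, ‖ν‖ = 1 ∧ ∀ x ∈ closure Ω, 0 ≤ ⟪ν, x - p⟫_ℝ := by
  obtain ⟨ℓ, hℓ⟩ := geometric_hahn_banach_open_point hconv hΩ (hΩ.frontier_eq ▸ hp).2
  set ν := (InnerProductSpace.toDual ℝ X).symm (-ℓ) with hν
  have happly (x : X) : ⟪ν, x⟫_ℝ = -ℓ x := by simp [hν]
  have hν0 : ν ≠ 0 := fun h0 => by
    obtain ⟨a, ha⟩ := hne
    have hlt := hℓ a ha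
    have ha0 := happly a
    have hp0 := happly p
    rw [h0, inner_zero_left] at ha0 hp0
    linarith
  refine ⟨‖ν‖⁻¹ • ν, norm_smul_inv_norm hν0, fun x hx => ?_⟩
  have hclosed : IsClosed {x : X | ℓ x ≤ ℓ p} := isClosed_le ℓ.continuous continuous_const
  have hle : ℓ x ≤ ℓ p := closure_minimal (fun y hy => (hℓ y hy).le) hclosed hx
  rw [real_inner_smul_left, happly, map_sub]
  exact mul_nonneg (by positivity) (by linarith)

lemma contDiff_inner_sub {k : WithTop ℕ∞} : ContDiff ℝ k fun y => ⟪ν, y - p⟫_ℝ :=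
  contDiff_const.inner ℝ (contDiff_id.sub contDiff_const)

lemma hessian_barrier (ν p : X) (a c : ℝ) (x v : X) :
    hessian (fun y => ⟪ν, y - p⟫_ℝ * (a - c * ⟪ν, y - p⟫_ℝ)) x v v = -2 * c * ⟪ν, v⟫_ℝ ^ 2 := by
  have hgrad : fderiv ℝ (fun y => ⟪ν, y - p⟫_ℝ) = fun _ => innerSL ℝ ν := by
    ext y v
    rw [fderiv_inner_apply ℝ (by fun_prop) (by fun_prop), fderiv_sub_const]
    simp
  have hgrad' : fderiv ℝ (fun y => a - c * ⟪ν, y - p⟫_ℝ) = fun _ => -(c • innerSL ℝ ν) := by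
    ext1 y
    rw [fderiv_const_sub, fderiv_const_mul (contDiff_inner_sub.contDiffAt.differentiableAt
      one_ne_zero), hgrad]
  have hsub : ContDiff ℝ 2 fun y => a - c * ⟪ν, y - p⟫_ℝ :=
    contDiff_const.sub (contDiff_const.mul contDiff_inner_sub)
  have hinner := hessian_inner_apply_self (x := x) hsub.contDiffAt
    (contDiff_inner_sub (ν := ν) (p := p)).contDiffAt v
  simp only [RCLike.inner_apply, conj_trivial] at hinner
  rw [hinner]
  simp [hessian, hgrad, hgrad']
  ring

variable [ProperSpace X] {K : ℝ}

lemma neg_mul_inner_sub_le (hΩ : IsOpen Ω) (hbdd : Bornology.IsBounded Ω) (hp : p ∈ closure Ω)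
    (hν : ‖ν‖ = 1) (hsupp : ∀ x ∈ closure Ω, 0 ≤ ⟪ν, x - p⟫_ℝ) {f : X → ℝ} (hK : 0 ≤ K)
    (hf : ContinuousOn f (closure Ω)) (hf2 : ∀ x ∈ Ω, ContDiffAt ℝ 2 f x)
    (hsum : ∀ x ∈ Ω, ∃ (k : ℕ) (b : Fin k → X),
      1 ≤ ∑ s, ⟪ν, b s⟫_ℝ ^ 2 ∧ ∑ s, hessian f x (b s) (b s) ≤ K)
    (hfront : ∀ x ∈ frontier Ω, 0 ≤ f x) {x : X} (hx : x ∈ closure Ω) :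
    -(K * diam Ω * ⟪ν, x - p⟫_ℝ) ≤ f x := by
  -- The slope `K * diam Ω` keeps `q` nonnegative on `closure Ω`, and the Hessian `-K * ⟪ν, ·⟫ ^ 2`
  -- of `q` absorbs that of `f`.
  set q : X → ℝ := fun y => ⟪ν, y - p⟫_ℝ * (K * diam Ω - K / 2 * ⟪ν, y - p⟫_ℝ) with hq
  have hqdiff : ContDiff ℝ 2 q :=
    contDiff_inner_sub.mul (contDiff_const.sub (contDiff_const.mul contDiff_inner_sub))
  have hqhess (y v : X) : hessian q y v v = -K * ⟪ν, v⟫_ℝ ^ 2 := by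
    rw [hq, hessian_barrier]
    ring
  have hwidth (y : X) (hy : y ∈ closure Ω) : ⟪ν, y - p⟫_ℝ ≤ diam Ω := by
    have hdist : dist y p ≤ diam Ω := diam_closure Ω ▸ dist_le_diam_of_mem hbdd.closure hy hp
    calc ⟪ν, y - p⟫_ℝ ≤ ‖ν‖ * ‖y - p‖ := real_inner_le_norm _ _
      _ ≤ diam Ω := by rwa [hν, one_mul, ← dist_eq_norm]
  have hqnonneg (y : X) (hy : y ∈ closure Ω) : 0 ≤ q y := by
    have := hwidth y hy
    have := hsupp y hy
    exact mul_nonneg this (by nlinarith)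
  have hcompare : 0 ≤ f x + q x := by
    refine le_of_sum_hessian_nonpos hΩ hbdd (f := fun y => f y + q y)
      (hf.add hqdiff.continuous.continuousOn) (fun y hy => (hf2 y hy).add hqdiff.contDiffAt)
      (fun y hy => ?_)
      (fun y hy => add_nonneg (hfront y hy) (hqnonneg y (frontier_subset_closure hy))) x hx
    obtain ⟨k, b, hb, hle⟩ := hsum y hy
    refine ⟨k, b, fun hb0 => by norm_num [hb0] at hb, ?_⟩
    simp only [hessian_add (hf2 y hy) hqdiff.contDiffAt, add_apply, Finset.sum_add_distrib,
      hqhess, ← Finset.mul_sum]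
    nlinarith
  have hqle : q x ≤ K * diam Ω * ⟪ν, x - p⟫_ℝ := by
    have := mul_nonneg hK (sq_nonneg ⟪ν, x - p⟫_ℝ)
    simp only [hq]
    linarith
  linarith

theorem norm_le_mul_inner_sub (hΩ : IsOpen Ω) (hbdd : Bornology.IsBounded Ω) (hp : p ∈ closure Ω)
    (hν : ‖ν‖ = 1) (hsupp : ∀ x ∈ closure Ω, 0 ≤ ⟪ν, x - p⟫_ℝ) {F : Type*}
    [NormedAddCommGroup F] [InnerProductSpace ℝ F] {w : X → F} (hK : 0 ≤ K)
    (hw : ContinuousOn w (closure Ω)) (hw2 : ∀ x ∈ Ω, ContDiffAt ℝ 2 w x)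
    (hsum : ∀ x ∈ Ω, ∃ (k : ℕ) (b : Fin k → X),
      1 ≤ ∑ s, ⟪ν, b s⟫_ℝ ^ 2 ∧ ‖∑ s, hessian w x (b s) (b s)‖ ≤ K)
    (hfront : ∀ x ∈ frontier Ω, w x = 0) {x : X} (hx : x ∈ closure Ω) :
    ‖w x‖ ≤ K * diam Ω * ⟪ν, x - p⟫_ℝ := by
  have hbarrier : -(‖w x‖ * K * diam Ω * ⟪ν, x - p⟫_ℝ) ≤ innerSL ℝ (-w x) (w x) := by
    refine neg_mul_inner_sub_le hΩ hbdd hp hν hsupp (f := fun y => innerSL ℝ (-w x) (w y))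
      (by positivity) ((innerSL ℝ (-w x)).continuous.comp_continuousOn hw)
      (fun y hy => (innerSL ℝ (-w x)).contDiff.contDiffAt.comp y (hw2 y hy)) (fun y hy => ?_)
      (fun y hy => by simp [hfront y hy]) hx
    obtain ⟨k, b, hb, hle⟩ := hsum y hy
    refine ⟨k, b, hb, ?_⟩
    calc ∑ s, hessian (fun z => innerSL ℝ (-w x) (w z)) y (b s) (b s)
        = ⟪-w x, ∑ s, hessian w y (b s) (b s)⟫_ℝ := by
          rw [inner_sum]
          exact Finset.sum_congr rfl fun s _ =>
            hessian_clm_comp (innerSL ℝ (-w x)) (hw2 y hy) (b s) (b s)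
      _ ≤ ‖-w x‖ * ‖∑ s, hessian w y (b s) (b s)‖ := real_inner_le_norm _ _
      _ ≤ ‖w x‖ * K := by rw [norm_neg]; gcongr
  rw [innerSL_apply_apply, inner_neg_left, real_inner_self_eq_norm_sq] at hbarrier
  rcases (norm_nonneg (w x)).eq_or_lt with h0 | hpos
  · rw [← h0]
    exact mul_nonneg (mul_nonneg hK diam_nonneg) (hsupp x hx)
  · exact le_of_mul_le_mul_left (by linarith) hpos

end Barrier

section TangentCone

open scoped InnerProductSpace Topology

variable {X F : Type*} [NormedAddCommGroup X] [NormedAddCommGroup F] [NormedSpace ℝ F] {c : ℝ}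

lemma exists_mem_openSegment_mem_frontier [NormedSpace ℝ X] {U : Set X} (hU : IsOpen U) {x y : X}
    (hx : x ∈ U) (hy : y ∉ closure U) : ∃ z ∈ openSegment ℝ x y, z ∈ frontier U := by
  suffices ∃ z ∈ segment ℝ x y, z ∈ frontier U by
    obtain ⟨z, hz, hfront⟩ := this
    refine ⟨z, mem_openSegment_of_ne_left_right ?_ ?_ hz, hfront⟩
    · rintro rfl
      exact (hU.frontier_eq ▸ hfront).2 hx
    · rintro rfl
      exact hy (frontier_subset_closure hfront)
  by_contra! hfront
  have hcover : segment ℝ x y ⊆ U ∪ (closure U)ᶜ := fun z hz => by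
    by_cases hzU : z ∈ U
    · exact .inl hzU
    · exact .inr fun hcl => hfront z hz (hU.frontier_eq ▸ ⟨hcl, hzU⟩)
  exact hy (subset_closure ((convex_segment x y).isPreconnected.subset_left_of_subset_union hU
    isClosed_closure.isOpen_compl (disjoint_compl_right_iff_subset.2 subset_closure) hcover
    ⟨x, left_mem_segment ℝ x y, hx⟩ (right_mem_segment ℝ x y)))

lemma norm_apply_le_of_mem_closure [NormedSpace ℝ X] {s : Set X} {A : X →L[ℝ] F}
    (hA : ∀ y ∈ s, ‖A y‖ ≤ c * ‖y‖) {v : X} (hv : v ∈ closure s) : ‖A v‖ ≤ c * ‖v‖ :=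
  closure_minimal hA
    (isClosed_le A.continuous.norm (continuous_const.mul continuous_norm)) hv

lemma norm_apply_le_of_cone [NormedSpace ℝ X] {C : ConvexCone ℝ X} (hC : IsOpen (C : Set X))
    (hne : (C : Set X).Nonempty) {A : X →L[ℝ] F} (hc : 0 ≤ c)
    (hfront : ∀ z ∈ frontier (C : Set X), A z = 0) (hA : ∀ y ∈ C, ‖A y‖ ≤ c * ‖y‖) (v : X) :
    ‖A v‖ ≤ c * ‖v‖ := by
  by_cases hv : v ∈ closure (C : Set X)
  · exact norm_apply_le_of_mem_closure hA hv
  by_cases hv' : -v ∈ closure (C : Set X)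
  · simpa using norm_apply_le_of_mem_closure hA hv'
  obtain ⟨y, hy⟩ := hne
  -- The segments from `y` to `v` and to `-v` both cross the frontier of `C`, and the two resulting
  -- linear relations force `A v = 0`.
  have hcross (z : X) (hz : z ∉ closure (C : Set X)) :
      ∃ a b : ℝ, 0 < a ∧ 0 < b ∧ a • A y + b • A z = 0 := by
    obtain ⟨_, ⟨a, b, ha, hb, -, rfl⟩, hf⟩ := exists_mem_openSegment_mem_frontier hC hy hz
    exact ⟨a, b, ha, hb, by simpa using hfront _ hf⟩
  obtain ⟨a₁, b₁, ha₁, hb₁, h₁⟩ := hcross v hv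
  obtain ⟨a₂, b₂, ha₂, hb₂, h₂⟩ := hcross (-v) hv'
  have hvanish : (a₂ * b₁ + a₁ * b₂) • A v = 0 := by
    calc (a₂ * b₁ + a₁ * b₂) • A v
        = a₂ • (a₁ • A y + b₁ • A v) - a₁ • (a₂ • A y + b₂ • A (-v)) := by
          rw [map_neg]
          module
      _ = 0 := by rw [h₁, h₂, smul_zero, smul_zero, sub_zero]
  have hAv : A v = 0 := (smul_eq_zero.1 hvanish).resolve_left (by positivity)
  rw [hAv, norm_zero]
  positivity

variable [InnerProductSpace ℝ X] {Ω : Set X} {p : X} {w : X → F} {A : X →L[ℝ] F}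

lemma exists_unit_inner_nonneg_of_mem_frontier_cone [CompleteSpace X] {C : ConvexCone ℝ X}
    (hC : IsOpen (C : Set X)) (hne : (C : Set X).Nonempty) {z : X}
    (hz : z ∈ frontier (C : Set X)) :
    ∃ ν : X, ‖ν‖ = 1 ∧ (∀ y ∈ C, 0 ≤ ⟪ν, y⟫_ℝ) ∧ ⟪ν, z⟫_ℝ = 0 := by
  obtain ⟨ν, hν, hsupp⟩ := exists_unit_inner_sub_nonneg hC hne C.convex hz
  have hzcl : z ∈ C.closure := frontier_subset_closure hz
  have hdouble := hsupp _ (C.closure.smul_mem two_pos hzcl)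
  have hhalf := hsupp _ (C.closure.smul_mem one_half_pos hzcl)
  simp only [inner_sub_right, inner_smul_right] at hdouble hhalf
  have hz0 : ⟪ν, z⟫_ℝ = 0 := by linarith
  refine ⟨ν, hν, fun y hy => ?_, hz0⟩
  simpa [inner_sub_right, hz0] using hsupp y (subset_closure hy)

lemma norm_apply_le_inner_of_add_smul_mem (hΩ : Convex ℝ Ω) (hp : p ∈ closure Ω)
    (hA : HasFDerivWithinAt w A (closure Ω) p) (hwp : w p = 0) {ν v : X}
    (hw : ∀ x ∈ closure Ω, ‖w x‖ ≤ c * ⟪ν, x - p⟫_ℝ) {t : ℝ} (ht : 0 < t)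
    (hmem : p + t • v ∈ Ω) : ‖A v‖ ≤ c * ⟪ν, v⟫_ℝ := by
  have hray : ∀ᶠ s in 𝓝[>] (0 : ℝ), p + s • v ∈ closure Ω := by
    filter_upwards [Ioo_mem_nhdsGT ht] with s hs
    have hs1 : s / t ∈ Icc (0 : ℝ) 1 :=
      ⟨div_nonneg hs.1.le ht.le, (div_le_one ht).2 hs.2.le⟩
    have := hΩ.closure.add_smul_mem hp (subset_closure hmem) hs1
    rwa [smul_smul, div_mul_cancel₀ _ ht.ne'] at this
  have hlim : Filter.Tendsto (fun s : ℝ => s⁻¹ • (w (p + s • v) - w p)) (𝓝[>] 0) (𝓝 (A v)) := by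
    refine hA.lim ?_ hray ?_
    · have hcont : Continuous fun s : ℝ => s • v := by fun_prop
      simpa using (hcont.tendsto 0).mono_left nhdsWithin_le_nhds
    · refine tendsto_const_nhds.congr' ?_
      filter_upwards [self_mem_nhdsWithin] with s hs
      rw [inv_smul_smul₀ (ne_of_gt hs)]
  refine le_of_tendsto hlim.norm ?_
  filter_upwards [hray, self_mem_nhdsWithin] with s hs (hs0 : 0 < s)
  have hbound := hw _ hs
  rw [add_sub_cancel_left, inner_smul_right] at hbound
  rw [hwp, sub_zero, norm_smul, norm_inv, Real.norm_of_nonneg hs0.le, inv_mul_le_iff₀ hs0]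
  linarith

lemma exists_convexCone_mem_iff (hΩ : Convex ℝ Ω) (p : X) :
    ∃ C : ConvexCone ℝ X, ∀ y, y ∈ C ↔ ∃ t : ℝ, 0 < t ∧ p + t • y ∈ Ω := by
  refine ⟨ConvexCone.hull ℝ ((fun z => p + z) ⁻¹' Ω), fun y => ?_⟩
  rw [ConvexCone.mem_hull_of_convex (hΩ.translate_preimage_right p)]
  constructor
  · rintro ⟨t, ht, z, hz, rfl⟩
    exact ⟨t⁻¹, inv_pos.2 ht, by simpa [ht.ne'] using hz⟩
  · rintro ⟨t, ht, hy⟩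
    exact ⟨t⁻¹, inv_pos.2 ht, t • y, hy, by simp [ht.ne']⟩

theorem norm_apply_le_of_forall_support [CompleteSpace X] (hΩ : IsOpen Ω) (hne : Ω.Nonempty)
    (hconv : Convex ℝ Ω) (hp : p ∈ frontier Ω) (hA : HasFDerivWithinAt w A (closure Ω) p)
    (hwp : w p = 0) (hc : 0 ≤ c)
    (hw : ∀ ν : X, ‖ν‖ = 1 → (∀ x ∈ closure Ω, 0 ≤ ⟪ν, x - p⟫_ℝ) →
      ∀ x ∈ closure Ω, ‖w x‖ ≤ c * ⟪ν, x - p⟫_ℝ) (v : X) :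
    ‖A v‖ ≤ c * ‖v‖ := by
  obtain ⟨C, hmemC⟩ := exists_convexCone_mem_iff hconv p
  have hsubC {x : X} (hx : x ∈ Ω) : x - p ∈ C := (hmemC _).2 ⟨1, one_pos, by simpa using hx⟩
  have hCopen : IsOpen (C : Set X) := by
    have : (C : Set X) = ⋃ t ∈ Ioi (0 : ℝ), (fun y => p + t • y) ⁻¹' Ω := by
      ext y
      simp [hmemC]
    rw [this]
    exact isOpen_biUnion fun t _ => hΩ.preimage (by fun_prop)
  have hbound {ν : X} (hν : ‖ν‖ = 1) (hnonneg : ∀ y ∈ C, 0 ≤ ⟪ν, y⟫_ℝ) {y : X} (hy : y ∈ C) :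
      ‖A y‖ ≤ c * ⟪ν, y⟫_ℝ := by
    obtain ⟨t, ht, hmem⟩ := (hmemC y).1 hy
    have hclosed : IsClosed {x : X | 0 ≤ ⟪ν, x - p⟫_ℝ} := isClosed_le continuous_const (by fun_prop)
    exact norm_apply_le_inner_of_add_smul_mem hconv (frontier_subset_closure hp) hA hwp
      (hw ν hν (closure_minimal (fun x hx => hnonneg _ (hsubC hx)) hclosed)) ht hmem
  have hCne : (C : Set X).Nonempty := hne.imp' (· - p) fun x hx => hsubC hx
  refine norm_apply_le_of_cone hCopen hCne hc (fun z hz => ?_) (fun y hy => ?_) v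
  · obtain ⟨ν, hν, hnonneg, hνz⟩ := exists_unit_inner_nonneg_of_mem_frontier_cone hCopen hCne hz
    have hclosed : IsClosed {y : X | ‖A y‖ ≤ c * ⟪ν, y⟫_ℝ} :=
      isClosed_le (by fun_prop) (by fun_prop)
    have hz' : ‖A z‖ ≤ c * ⟪ν, z⟫_ℝ :=
      closure_minimal (fun y hy => hbound hν hnonneg hy) hclosed (frontier_subset_closure hz)
    simpa [hνz] using hz'
  · obtain ⟨ν, hν, hsupp⟩ := exists_unit_inner_sub_nonneg hΩ hne hconv hp
    obtain ⟨t, ht, hmem⟩ := (hmemC y).1 hy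
    calc ‖A y‖ ≤ c * ⟪ν, y⟫_ℝ :=
          norm_apply_le_inner_of_add_smul_mem hconv (frontier_subset_closure hp) hA hwp
            (hw ν hν hsupp) ht hmem
      _ ≤ c * ‖y‖ := by
          have := real_inner_le_norm ν y
          rw [hν, one_mul] at this
          gcongr

end TangentCone

section GradientEstimate

open scoped MatrixOrder Matrix.Norms.L2Operator InnerProductSpace Topology

variable {m : ℕ} {F : Type*} [NormedAddCommGroup F] [InnerProductSpace ℝ F] {Ω : Set (E m)}
  {φ u : E m → F} {κ c d M S : ℝ}

lemma fderivWithin_closure_of_mem (hΩ : IsOpen Ω) {x : E m} (hx : x ∈ Ω) :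
    fderivWithin ℝ u (closure Ω) x = fderiv ℝ u x :=
  fderivWithin_of_mem_nhds (Filter.mem_of_superset (hΩ.mem_nhds hx) subset_closure)

lemma uniqueDiffOn_closure (hΩ : IsOpen Ω) (hne : Ω.Nonempty) (hconv : Convex ℝ Ω) :
    UniqueDiffOn ℝ (closure Ω) :=
  uniqueDiffOn_convex hconv.closure (hne.mono (interior_maximal subset_closure hΩ))

lemma exists_frame_norm_sum_hessian_sub_le {x : E m} (hu : ContDiffAt ℝ 2 u x)
    (hφ : ContDiffAt ℝ 2 φ x) (hκ : 0 < κ) (hg : algebraMap ℝ _ κ ≤ graphMetric (fderiv ℝ u x))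
    (heq : contraction (hessian u x) (graphMetric (fderiv ℝ u x))⁻¹ = 0)
    (hφM : ∀ v, ‖hessian φ x v v‖ ≤ M * ‖v‖ ^ 2) {ν : E m} (hν : ‖ν‖ = 1) :
    ∃ (k : ℕ) (b : Fin k → E m), 1 ≤ ∑ s, ⟪ν, b s⟫_ℝ ^ 2 ∧
      ‖∑ s, hessian (fun y => u y - φ y) x (b s) (b s)‖ ≤ M * (m / κ) := by
  have hpos := posDef_of_algebraMap_le hκ hg
  have hM : 0 ≤ M := by simpa [hν] using (norm_nonneg _).trans (hφM ν)
  obtain ⟨k, b, hb⟩ := exists_isFrame hpos.inv.posSemidef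
  refine ⟨k, b, ?_, ?_⟩
  · have hinv := one_le_inv_of_le_one hpos (graphMetric_le_one _)
    rw [← map_one (algebraMap ℝ _), le_iff_dotProduct_mulVec_le (isHermitian_algebraMap 1)
      hpos.inv.isHermitian] at hinv
    simpa only [hb.sum_sq_inner, dotProduct_algebraMap_mulVec, hν, one_pow, mul_one] using hinv ν
  · have hsum : ∑ s, hessian (fun y => u y - φ y) x (b s) (b s) =
        -∑ s, hessian φ x (b s) (b s) := by
      rw [hb.contraction_eq] at heq
      simp only [hessian_sub hu hφ, sub_apply, Finset.sum_sub_distrib, heq, zero_sub]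
    calc ‖∑ s, hessian (fun y => u y - φ y) x (b s) (b s)‖
        ≤ ∑ s, M * ‖b s‖ ^ 2 := by
          rw [hsum, norm_neg]
          exact norm_sum_le_of_le _ fun s _ => hφM (b s)
      _ = M * (graphMetric (fderiv ℝ u x))⁻¹.trace := by rw [← Finset.mul_sum, hb.trace_eq]
      _ ≤ M * (m / κ) := by
          gcongr
          simpa using trace_inv_le hκ hg

theorem norm_fderivWithin_frontier_le (hΩ : IsOpen Ω) (hne : Ω.Nonempty)
    (hbdd : Bornology.IsBounded Ω) (hconv : Convex ℝ Ω) (hu : ContDiffOn ℝ 2 u Ω)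
    (hu1 : ContDiffOn ℝ 1 u (closure Ω)) (hφ : ContDiffOn ℝ 2 φ (closure Ω)) (hκ : 0 < κ)
    (hg : ∀ x ∈ Ω, algebraMap ℝ _ κ ≤ graphMetric (fderiv ℝ u x))
    (heq : ∀ x ∈ Ω, contraction (hessian u x) (graphMetric (fderiv ℝ u x))⁻¹ = 0)
    (hφM : ∀ x ∈ Ω, ∀ v, ‖hessian φ x v v‖ ≤ M * ‖v‖ ^ 2)
    (hfront : ∀ x ∈ frontier Ω, u x = φ x) {p : E m} (hp : p ∈ frontier Ω) :
    ‖fderivWithin ℝ u (closure Ω) p‖ ≤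
      M * (m / κ) * diam Ω + ‖fderivWithin ℝ φ (closure Ω) p‖ := by
  have hpcl : p ∈ closure Ω := frontier_subset_closure hp
  have hM : 0 ≤ M := by
    obtain ⟨a, ha⟩ := hne
    obtain ⟨ν, hν, -⟩ := exists_unit_inner_sub_nonneg hΩ ⟨a, ha⟩ hconv hp
    simpa [hν] using (norm_nonneg _).trans (hφM a ha ν)
  have hdiff : HasFDerivWithinAt (fun y => u y - φ y)
      (fderivWithin ℝ u (closure Ω) p - fderivWithin ℝ φ (closure Ω) p) (closure Ω) p :=
    ((hu1.differentiableOn one_ne_zero) p hpcl).hasFDerivWithinAt.sub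
      ((hφ.differentiableOn two_ne_zero) p hpcl).hasFDerivWithinAt
  have hu2 (x : E m) (hx : x ∈ Ω) : ContDiffAt ℝ 2 u x := hu.contDiffAt (hΩ.mem_nhds hx)
  have hφ2 (x : E m) (hx : x ∈ Ω) : ContDiffAt ℝ 2 φ x :=
    (hφ.mono subset_closure).contDiffAt (hΩ.mem_nhds hx)
  have hdiff_le : ‖fderivWithin ℝ u (closure Ω) p - fderivWithin ℝ φ (closure Ω) p‖ ≤
      M * (m / κ) * diam Ω := by
    refine ContinuousLinearMap.opNorm_le_bound _ (by positivity) ?_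
    refine norm_apply_le_of_forall_support hΩ hne hconv hp hdiff (sub_eq_zero.2 (hfront p hp))
      (by positivity) fun ν hν hsupp x hx => ?_
    exact norm_le_mul_inner_sub hΩ hbdd hpcl hν hsupp (by positivity)
      (hu1.continuousOn.sub hφ.continuousOn) (fun y hy => (hu2 y hy).sub (hφ2 y hy))
      (fun y hy => exists_frame_norm_sum_hessian_sub_le (hu2 y hy) (hφ2 y hy) hκ (hg y hy)
        (heq y hy) (hφM y hy) hν)
      (fun y hy => sub_eq_zero.2 (hfront y hy)) hx
  linarith [norm_le_norm_add_norm_sub' (fderivWithin ℝ u (closure Ω) p)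
    (fderivWithin ℝ φ (closure Ω) p)]

lemma continuousOn_det_graphMetric (hΩ : IsOpen Ω) (hne : Ω.Nonempty) (hconv : Convex ℝ Ω)
    (hu1 : ContDiffOn ℝ 1 u (closure Ω)) :
    ContinuousOn (fun x => (graphMetric (fderivWithin ℝ u (closure Ω) x)).det) (closure Ω) :=
  (contDiff_graphMetric (k := 0)).continuous.matrix_det.comp_continuousOn
    (hu1.continuousOn_fderivWithin (uniqueDiffOn_closure hΩ hne hconv) le_rfl)

theorem le_det_graphMetric_of_le_frontier (hm : 0 < m) (hΩ : IsOpen Ω) (hne : Ω.Nonempty)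
    (hbdd : Bornology.IsBounded Ω) (hconv : Convex ℝ Ω) (hu : ContDiffOn ℝ 3 u Ω)
    (hu1 : ContDiffOn ℝ 1 u (closure Ω))
    (hpos : ∀ x ∈ Ω, (graphMetric (fderiv ℝ u x)).PosDef)
    (heq : ∀ x ∈ Ω, contraction (hessian u x) (graphMetric (fderiv ℝ u x))⁻¹ = 0) (hd : 0 < d)
    (hfront : ∀ x ∈ frontier Ω, d ≤ (graphMetric (fderivWithin ℝ u (closure Ω) x)).det) {x : E m}
    (hx : x ∈ Ω) : d ≤ (graphMetric (fderiv ℝ u x)).det := by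
  set D : E m → ℝ := fun y => (graphMetric (fderivWithin ℝ u (closure Ω) y)).det with hD
  have : Nonempty (Fin m) := Fin.pos_iff_nonempty.1 hm
  have hDeq {y : E m} (hy : y ∈ Ω) : D y = (graphMetric (fderiv ℝ u y)).det := by
    simp only [hD, fderivWithin_closure_of_mem hΩ hy]
  have hDpos (y : E m) (hy : y ∈ closure Ω) : 0 < D y := by
    by_cases hyΩ : y ∈ Ω
    · exact hDeq hyΩ ▸ (hpos y hyΩ).det_pos
    · exact hd.trans_le (hfront y (hΩ.frontier_eq ▸ ⟨hy, hyΩ⟩))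
  have hlogD {y : E m} (hy : y ∈ Ω) : (fun z => Real.log (D z)) =ᶠ[𝓝 y]
      fun z => Real.log (graphMetric (fderiv ℝ u z)).det := by
    filter_upwards [hΩ.mem_nhds hy] with z hz
    rw [hDeq hz]
  have hu3 {y : E m} (hy : y ∈ Ω) : ContDiffAt ℝ 3 u y := hu.contDiffAt (hΩ.mem_nhds hy)
  have hlog : Real.log d ≤ Real.log (D x) := by
    refine le_of_sum_hessian_nonpos hΩ hbdd (f := fun y => Real.log (D y))
      ((continuousOn_det_graphMetric hΩ hne hconv hu1).log fun y hy => (hDpos y hy).ne')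
      (fun y hy => ?_) (fun y hy => ?_) (fun y hy => Real.log_le_log hd (hfront y hy)) x
      (subset_closure hx)
    · have hDu : ContDiffAt ℝ 2 (fderiv ℝ u) y := (hu3 hy).fderiv_right (by norm_num)
      exact (contDiffAt_log_det (contDiff_graphMetric.contDiffAt.comp y hDu)
        (hpos y hy).isUnit).congr_of_eventuallyEq (hlogD hy)
    · obtain ⟨k, b, hb⟩ := exists_isFrame (hpos y hy).inv.posSemidef
      refine ⟨k, b, hb.ne_zero (hpos y hy).inv.isUnit.ne_zero, ?_⟩
      rw [hessian, (hlogD hy).fderiv.fderiv_eq]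
      exact sum_hessian_log_det_graphMetric_nonpos (hu3 hy) (hpos y hy)
        (Filter.mem_of_superset (hΩ.mem_nhds hy) heq) hb
  rw [← hDeq hx]
  exact (Real.log_le_log_iff hd (hDpos x (subset_closure hx))).1 hlog

theorem norm_fderiv_sq_le (hm : 0 < m) (hΩ : IsOpen Ω) (hne : Ω.Nonempty)
    (hbdd : Bornology.IsBounded Ω) (hconv : Convex ℝ Ω) (hu : ContDiffOn ℝ 3 u Ω)
    (hu1 : ContDiffOn ℝ 1 u (closure Ω)) (hφ : ContDiffOn ℝ 2 φ (closure Ω)) (hκ : 0 < κ)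
    (hκu : ∀ x ∈ Ω, ‖fderiv ℝ u x‖ ^ 2 ≤ 1 - κ)
    (heq : ∀ x ∈ Ω, contraction (hessian u x) (graphMetric (fderiv ℝ u x))⁻¹ = 0)
    (hφM : ∀ x ∈ Ω, ∀ v, ‖hessian φ x v v‖ ≤ M * ‖v‖ ^ 2)
    (hφS : ∀ x ∈ frontier Ω, ‖fderivWithin ℝ φ (closure Ω) x‖ ≤ S)
    (hfront : ∀ x ∈ frontier Ω, u x = φ x) (hc : M * (m / κ) * diam Ω + S ≤ c) (hc0 : 0 ≤ c)
    (hc1 : c < 1) {x : E m} (hx : x ∈ Ω) :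
    ‖fderiv ℝ u x‖ ^ 2 ≤ 1 - (1 - c ^ 2) ^ m := by
  have hκ1 : κ ≤ 1 := by linarith [hκu x hx, sq_nonneg ‖fderiv ℝ u x‖]
  have hg (y : E m) (hy : y ∈ Ω) : algebraMap ℝ _ κ ≤ graphMetric (fderiv ℝ u y) :=
    (algebraMap_le_graphMetric_iff hκ1).2 (hκu y hy)
  have hpos (y : E m) (hy : y ∈ Ω) := posDef_of_algebraMap_le hκ (hg y hy)
  have hc2 : 0 < 1 - c ^ 2 := by nlinarith
  have hdet_front (p : E m) (hp : p ∈ frontier Ω) :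
      (1 - c ^ 2) ^ m ≤ (graphMetric (fderivWithin ℝ u (closure Ω) p)).det := by
    have hgrad : ‖fderivWithin ℝ u (closure Ω) p‖ ≤ c := by
      have := norm_fderivWithin_frontier_le hΩ hne hbdd hconv (hu.of_le (by norm_num)) hu1 hφ hκ
        hg heq hφM hfront hp
      linarith [hφS p hp]
    have hg_front : algebraMap ℝ _ (1 - c ^ 2) ≤ graphMetric (fderivWithin ℝ u (closure Ω) p) := by
      rw [algebraMap_le_graphMetric_iff (by nlinarith), sub_sub_cancel]
      gcongr
    simpa using pow_card_le_det hc2.le hg_front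
  have hdet := le_det_graphMetric_of_le_frontier hm hΩ hne hbdd hconv hu hu1 hpos heq
    (pow_pos hc2 m) hdet_front hx
  have hg_ge : algebraMap ℝ _ ((1 - c ^ 2) ^ m) ≤ graphMetric (fderiv ℝ u x) :=
    (algebraMap_mono _ hdet).trans (algebraMap_det_le (hpos x hx).posSemidef.nonneg
      (graphMetric_le_one _))
  exact (algebraMap_le_graphMetric_iff (pow_le_one₀ hc2.le (by nlinarith))).1 hg_ge

end GradientEstimate

section SupNorm

variable {m n : ℕ} {Ω : Set (E m)} {φ : E m → E n}

lemma supNorm_eq_norm (A : E m →L[ℝ] E n) : supNorm A = ‖A‖ :=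
  A.sSup_sphere_eq_norm

variable (B : ContinuousMultilinearMap ℝ (fun _ : Fin 2 => E m) (E n))

lemma norm_apply_le_norm_of_mem_sphere {v : E m} (hv : v ∈ sphere 0 1) : ‖B ![v, v]‖ ≤ ‖B‖ := by
  simpa [mem_sphere_zero_iff_norm.1 hv] using B.le_opNorm ![v, v]

lemma supNorm₂_le_norm : supNorm₂ B ≤ ‖B‖ :=
  Real.sSup_le (forall_mem_image.2 fun _ => norm_apply_le_norm_of_mem_sphere B) (norm_nonneg B)

lemma supNorm₂_nonneg : 0 ≤ supNorm₂ B :=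
  Real.sSup_nonneg (forall_mem_image.2 fun _ _ => norm_nonneg _)

lemma norm_apply_le_supNorm₂ (v : E m) : ‖B ![v, v]‖ ≤ supNorm₂ B * ‖v‖ ^ 2 := by
  rcases eq_or_ne v 0 with rfl | hv
  · simp [B.map_coord_zero (m := ![0, 0]) 0 rfl]
  have hunit : ‖B ![‖v‖⁻¹ • v, ‖v‖⁻¹ • v]‖ ≤ supNorm₂ B :=
    le_csSup ⟨‖B‖, forall_mem_image.2 fun _ => norm_apply_le_norm_of_mem_sphere B⟩
      (mem_image_of_mem _ (mem_sphere_zero_iff_norm.2 (norm_smul_inv_norm hv)))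
  have hscale : B ![‖v‖⁻¹ • v, ‖v‖⁻¹ • v] = ‖v‖⁻¹ ^ 2 • B ![v, v] := by
    have hvec : ![‖v‖⁻¹ • v, ‖v‖⁻¹ • v] = fun i => ‖v‖⁻¹ • ![v, v] i := by
      ext1 i
      fin_cases i <;> rfl
    rw [hvec, B.map_smul_univ, Fin.prod_const]
  rw [hscale, norm_smul, norm_pow, norm_inv, norm_norm, inv_pow,
    inv_mul_le_iff₀ (by positivity)] at hunit
  linarith

lemma norm_hessian_apply_le_sSup (hΩ : IsOpen Ω) (hne : Ω.Nonempty)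
    (hbdd : Bornology.IsBounded Ω) (hconv : Convex ℝ Ω) (hφ : ContDiffOn ℝ 2 φ (closure Ω))
    {x : E m} (hx : x ∈ Ω) (v : E m) :
    ‖hessian φ x v v‖ ≤ sSup ((fun x => supNorm₂ (iteratedFDeriv ℝ 2 φ x)) '' Ω) * ‖v‖ ^ 2 := by
  have huniq := uniqueDiffOn_closure hΩ hne hconv
  obtain ⟨C, hC⟩ := hbdd.isCompact_closure.exists_bound_of_continuousOn
    (hφ.continuousOn_iteratedFDerivWithin (m := 2) le_rfl huniq)
  have hbound : BddAbove ((fun x => supNorm₂ (iteratedFDeriv ℝ 2 φ x)) '' Ω) := by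
    refine ⟨C, forall_mem_image.2 fun y hy => (supNorm₂_le_norm _).trans ?_⟩
    rw [← iteratedFDerivWithin_eq_iteratedFDeriv huniq
      ((hφ.mono subset_closure).contDiffAt (hΩ.mem_nhds hy)) (subset_closure hy)]
    exact hC y (subset_closure hy)
  calc ‖hessian φ x v v‖ = ‖iteratedFDeriv ℝ 2 φ x ![v, v]‖ := by
        simp [iteratedFDeriv_two_apply]
    _ ≤ supNorm₂ (iteratedFDeriv ℝ 2 φ x) * ‖v‖ ^ 2 := norm_apply_le_supNorm₂ _ v
    _ ≤ _ := by
        gcongr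
        exact le_csSup hbound (mem_image_of_mem _ hx)

lemma norm_fderivWithin_le_sSup (hΩ : IsOpen Ω) (hne : Ω.Nonempty)
    (hbdd : Bornology.IsBounded Ω) (hconv : Convex ℝ Ω) (hφ : ContDiffOn ℝ 1 φ (closure Ω))
    {p : E m} (hp : p ∈ frontier Ω) :
    ‖fderivWithin ℝ φ (closure Ω) p‖ ≤
      sSup ((fun x => supNorm (fderivWithin ℝ φ (closure Ω) x)) '' frontier Ω) := by
  obtain ⟨C, hC⟩ := hbdd.isCompact_closure.exists_bound_of_continuousOn
    (hφ.continuousOn_fderivWithin (uniqueDiffOn_closure hΩ hne hconv) le_rfl)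
  simp only [supNorm_eq_norm]
  exact le_csSup ⟨C, forall_mem_image.2 fun y hy => hC y (frontier_subset_closure hy)⟩
    (mem_image_of_mem _ hp)

lemma sSup_supNorm₂_nonneg : 0 ≤ sSup ((fun x => supNorm₂ (iteratedFDeriv ℝ 2 φ x)) '' Ω) :=
  Real.sSup_nonneg (forall_mem_image.2 fun _ _ => supNorm₂_nonneg _)

lemma sSup_supNorm_nonneg :
    0 ≤ sSup ((fun x => supNorm (fderivWithin ℝ φ (closure Ω) x)) '' frontier Ω) :=
  Real.sSup_nonneg (forall_mem_image.2 fun _ _ => by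
    simpa only [supNorm_eq_norm] using norm_nonneg _)

lemma IsSmoothSolution.norm_fderiv_sq_le_sSup {u : E m → E n} (hu : IsSmoothSolution Ω φ u)
    {x : E m} (hx : x ∈ Ω) :
    ‖fderiv ℝ u x‖ ^ 2 ≤ sSup ((fun x => supNorm (fderiv ℝ u x) ^ 2) '' Ω) := by
  have hspacelike := hu.spacelike
  simp only [supNorm_eq_norm] at hspacelike ⊢
  exact le_csSup ⟨1, forall_mem_image.2 fun y hy =>
    pow_le_one₀ (norm_nonneg _) (hspacelike y hy).le⟩ (mem_image_of_mem _ hx)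

lemma IsSmoothSolution.contraction_eq_zero {u : E m → E n} (hu : IsSmoothSolution Ω φ u)
    {x : E m} (hx : x ∈ Ω) : contraction (hessian u x) (graphMetric (fderiv ℝ u x))⁻¹ = 0 := by
  rw [← inducedMetric_eq_graphMetric, ← maximalOperator_eq_contraction, hu.maximal x hx]

lemma lt_one_sub_sq_pow {κ c : ℝ} (hm : 0 < m) (hκ : 0 < κ) (hc : 0 ≤ c)
    (hlt : c < √(1 - κ ^ (1 / (m : ℝ)))) : κ < (1 - c ^ 2) ^ m := by
  have hsq : c ^ 2 < 1 - κ ^ (1 / (m : ℝ)) := (Real.lt_sqrt hc).1 hlt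
  calc κ = (κ ^ (1 / (m : ℝ))) ^ m := by rw [one_div, Real.rpow_inv_natCast_pow hκ.le hm.ne']
    _ < (1 - c ^ 2) ^ m := pow_lt_pow_left₀ (by linarith) (by positivity) hm.ne'

end SupNorm

end MaximalGraph

theorem mainTheorem3_general (m n : ℕ) (hm : 0 < m)
    (Ω : Set (MaximalGraph.E m)) (hΩ_open : IsOpen Ω) (hΩ_ne : Ω.Nonempty)
    (hΩ_bdd : Bornology.IsBounded Ω) (hΩ_conv : Convex ℝ Ω)
    (φ : MaximalGraph.E m → MaximalGraph.E n) (hφ : ContDiffOn ℝ 2 φ (closure Ω))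
    (κ : ℝ) (hκ0 : 0 < κ)
    (hsmall :
      (m : ℝ) * Metric.diam Ω / κ *
          sSup ((fun x => MaximalGraph.supNorm₂ (iteratedFDeriv ℝ 2 φ x)) '' Ω) +
        sSup ((fun x => MaximalGraph.supNorm (fderivWithin ℝ φ (closure Ω) x)) ''
          frontier Ω) <
      Real.sqrt (1 - κ ^ (1 / (m : ℝ))))
    (u : MaximalGraph.E m → MaximalGraph.E n)
    (hu : MaximalGraph.IsSmoothSolution Ω φ u)
    (hgrad : sSup ((fun x => MaximalGraph.supNorm (fderiv ℝ u x) ^ 2) '' Ω) ≤ 1 - κ) :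
    sSup ((fun x => MaximalGraph.supNorm (fderiv ℝ u x) ^ 2) '' Ω) < 1 - κ := by
  set M := sSup ((fun x => MaximalGraph.supNorm₂ (iteratedFDeriv ℝ 2 φ x)) '' Ω)
  set S := sSup ((fun x => MaximalGraph.supNorm (fderivWithin ℝ φ (closure Ω) x)) '' frontier Ω)
  set c := (m : ℝ) * Metric.diam Ω / κ * M + S
  have hM : 0 ≤ M := MaximalGraph.sSup_supNorm₂_nonneg
  have hS : 0 ≤ S := MaximalGraph.sSup_supNorm_nonneg
  have hc : 0 ≤ c := by positivity
  have hκc : κ < (1 - c ^ 2) ^ m := MaximalGraph.lt_one_sub_sq_pow hm hκ0 hc hsmall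
  have hc1 : c < 1 := hsmall.trans_le (Real.sqrt_le_one.2 (sub_le_self 1 (by positivity)))
  suffices ∀ x ∈ Ω, MaximalGraph.supNorm (fderiv ℝ u x) ^ 2 ≤ 1 - (1 - c ^ 2) ^ m from
    (csSup_le (hΩ_ne.image _) (forall_mem_image.2 this)).trans_lt (sub_lt_sub_left hκc 1)
  intro x hx
  rw [MaximalGraph.supNorm_eq_norm]
  exact MaximalGraph.norm_fderiv_sq_le hm hΩ_open hΩ_ne hΩ_bdd hΩ_conv
    (hu.smooth.of_le ENat.LEInfty.out) hu.contDiffOn_closure hφ hκ0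
    (fun y hy => (hu.norm_fderiv_sq_le_sSup hy).trans hgrad)
    (fun y hy => hu.contraction_eq_zero hy)
    (fun y hy => MaximalGraph.norm_hessian_apply_le_sSup hΩ_open hΩ_ne hΩ_bdd hΩ_conv hφ hy)
    (fun y hy => MaximalGraph.norm_fderivWithin_le_sSup hΩ_open hΩ_ne hΩ_bdd hΩ_conv
      (hφ.of_le one_le_two) hy)
    hu.boundary (le_of_eq (by ring)) hc hc1 hx

theorem mainTheorem3 (m n : ℕ) (hm : 2 ≤ m) (hn : 1 ≤ n)
    (Ω : Set (MaximalGraph.E m)) (hΩ_open : IsOpen Ω) (hΩ_ne : Ω.Nonempty)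
    (hΩ_bdd : Bornology.IsBounded Ω) (hΩ_conv : Convex ℝ Ω)
    (hΩ_C2 : MaximalGraph.HasC2Boundary Ω)
    (φ : MaximalGraph.E m → MaximalGraph.E n) (hφ : ContDiffOn ℝ 2 φ (closure Ω))
    (κ : ℝ) (hκ0 : 0 < κ) (hκ1 : κ < 1)
    (hsmall :
      4 * (m : ℝ) * Metric.diam Ω / κ *
          sSup ((fun x => MaximalGraph.supNorm₂ (iteratedFDeriv ℝ 2 φ x)) '' Ω) +
        2 * sSup ((fun x => MaximalGraph.supNorm (fderivWithin ℝ φ (closure Ω) x)) ''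
          frontier Ω) <
      Real.sqrt (1 - κ ^ (1 / (m : ℝ))))
    (u : MaximalGraph.E m → MaximalGraph.E n)
    (hu : MaximalGraph.IsSmoothSolution Ω φ u)
    (hgrad : sSup ((fun x => MaximalGraph.supNorm (fderiv ℝ u x) ^ 2) '' Ω) ≤ 1 - κ) :
    sSup ((fun x => MaximalGraph.supNorm (fderiv ℝ u x) ^ 2) '' Ω) < 1 - κ := by
  refine mainTheorem3_general m n (by omega) Ω hΩ_open hΩ_ne hΩ_bdd hΩ_conv φ hφ κ hκ0
    (lt_of_le_of_lt ?_ hsmall) u hu hgrad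
  have hM := MaximalGraph.sSup_supNorm₂_nonneg (Ω := Ω) (φ := φ)
  have hS := MaximalGraph.sSup_supNorm_nonneg (Ω := Ω) (φ := φ)
  have hcoeff : (m : ℝ) * Metric.diam Ω / κ ≤ 4 * (m : ℝ) * Metric.diam Ω / κ := by
    gcongr
    linarith [m.cast_nonneg (α := ℝ)]
  exact add_le_add (mul_le_mul_of_nonneg_right hcoeff hM) (by linarith)
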